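/- Let $\mathfrak{su}(2)$ be the Lie algebra of traceless skew-Hermitian complex $2\times 2$ matrices, with an $\mathrm{ad}$-invariant inner product $\langle x,y\rangle=-c\,\mathrm{tr}(xy)$, $c>0$ (a positive multiple of minus the Killing form), and put $\Phi(a)=\langle a_1,[a_2,a_3]\rangle$ for $a=(a_1,a_2,a_3)\in\mathfrak{su}(2)^3$. Let $l^j_\xi(a)=\langle \xi,a_j\rangle$ for $\xi\in\mathfrak{su}(2)$, and on $\mathfrak{su}(2)^3_\star=\{\Phi\neq 0\}$ let $\pi_1$ be the bivector field with $$\{l^1_\xi,l^1_\zeta\}=l^1_{[\xi,\zeta]},\quad \{l^1_\xi,l^2_\zeta\}=\{l^2_\xi,l^1_\zeta\}=l^2_{[\xi,\zeta]},\quad \{l^1_\xi,l^3_\zeta\}=\{l^3_\xi,l^1_\zeta\}=l^3_{[\xi,\zeta]},$$ $$\{l^2_\xi,l^2_\zeta\}=\{l^3_\xi,l^3_\zeta\}=-l^1_{[\xi,\zeta]},\quad \{l^2_\xi,l^3_\zeta\}=-\{l^3_\xi,l^2_\zeta\}=A_{\xi,\zeta},$$ where $A_{\xi,\zeta}=\Phi^{-1}\big(\langle\xi,[a_1,a_2]\rangle\langle\zeta,[a_1,a_2]\rangle+\langle\xi,[a_2,a_3]\rangle\langle\zeta,[a_2,a_3]\rangle+\langle\xi,[a_3,a_1]\rangle\langle\zeta,[a_3,a_1]\rangle\big)$.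 Let $\pi_2=\sigma_*\pi_1$ and $\pi_3=\sigma_*\pi_2$ with $\sigma(a_1,a_2,a_3)=(a_3,a_1,a_2)$. For $q,r\ge 0$ let $$N_{q,r}=\{a\in\mathfrak{su}(2)^3 : \Phi(a)<0,\ \langle a_i,a_j\rangle=0\ (i\neq j),\ \langle a_1,a_1\rangle-\langle a_2,a_2\rangle=q,\ \langle a_2,a_2\rangle-\langle a_3,a_3\rangle=r\}.$$ This is a common symplectic leaf of the Poisson structures $\pi_1,\pi_2,\pi_3$, and the symplectic forms $\omega_1,\omega_2,\omega_3$ that they induce on it (with $\omega_i^\flat$ the inverse of $\pi_i^\sharp$) make it a hyperkähler manifold. The leaf $N_{q,r}$ is of type $0$ if $q=r=0$, of type $1$ if $q>0$ and $r=0$, and of type $2$ if $r>0$. An isomorphism of hyperkähler manifolds $(\tilde M,\tilde\omega_1,\tilde\omega_2,\tilde\omega_3)\to(M,\omega_1,\omega_2,\omega_3)$ is a diffeomorphism $F:\tilde M\to M$ such that $F^*(\omega_1,\omega_2,\omega_3)=(\tilde\omega_1,\tilde\omega_2,\tilde\omega_3)\,O$ for some $O\in \mathrm{SO}(3)$. Then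 two leaves $N_{q,r}$ and $N_{q',r'}$ ($q,r,q',r'\ge 0$) of different types are never isomorphic as hyperkähler manifolds. -/

import Mathlib

/-! ## The Lie algebra `su(2)` -/

attribute [local instance 100] LieRing.ofAssociativeRing

/-- The real Lie algebra `su(2)` of traceless skew-Hermitian complex `2 × 2` matrices, with the
commutator bracket. -/
def su2 : LieSubalgebra ℝ (Matrix (Fin 2) (Fin 2) ℂ) where
  carrier := {x | x.conjTranspose = -x ∧ x.trace = 0}
  add_mem' := by
    rintro x y ⟨hx, hx'⟩ ⟨hy, hy'⟩
    refine ⟨?_, ?_⟩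
    · rw [Matrix.conjTranspose_add, hx, hy, neg_add]
    · rw [Matrix.trace_add, hx', hy', add_zero]
  zero_mem' := by simp
  smul_mem' := by
    rintro t x ⟨hx, hx'⟩
    refine ⟨?_, ?_⟩
    · rw [Matrix.conjTranspose_smul, hx, star_trivial, smul_neg]
    · rw [Matrix.trace_smul, hx', smul_zero]
  lie_mem' := by
    rintro x y ⟨hx, -⟩ ⟨hy, -⟩
    refine ⟨?_, ?_⟩
    · rw [Ring.lie_def, Matrix.conjTranspose_sub, Matrix.conjTranspose_mul,
        Matrix.conjTranspose_mul, hx, hy]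
      noncomm_ring
    · rw [Ring.lie_def, Matrix.trace_sub, Matrix.trace_mul_comm, sub_self]

/- The entrywise sup norm on matrices, and thereby on `su(2)`. It serves only to speak of smoothness
and of derivatives, for which the choice of the norm on a finite-dimensional space is irrelevant. -/
attribute [local instance] Matrix.normedAddCommGroup Matrix.normedSpace

/-- The topology of the norm; it is the subspace topology. -/
noncomputable instance su2TopologicalSpace : TopologicalSpace su2 :=
  (AddSubgroupClass.normedAddCommGroup su2).toPseudoMetricSpace.toUniformSpace.toTopologicalSpace

/-- The space `su(2)³`. The components `a₁, a₂, a₃` are `a 0, a 1, a 2`. -/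
abbrev Triple : Type := Fin 3 → su2

/-- The inner product `⟨x, y⟩ = -c tr(xy)` on `su(2)`. For `c > 0` these are exactly the
inner products with `⟨[x, y], z⟩ = ⟨x, [y, z]⟩`, i.e. the positive multiples of minus the Killing
form `4 tr(xy)`; for `c = 2` an oriented orthonormal basis satisfies `[e₁, e₂] = e₃` cyclically. -/
noncomputable def ip (c : ℝ) (x y : su2) : ℝ :=
  -c * (Matrix.trace ((x : Matrix (Fin 2) (Fin 2) ℂ) * (y : Matrix (Fin 2) (Fin 2) ℂ))).re

/-- The function `Φ(a₁, a₂, a₃) = ⟨a₁, [a₂, a₃]⟩`. -/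
noncomputable def Phi (c : ℝ) (a : Triple) : ℝ := ip c (a 0) ⁅a 1, a 2⁆

/-! ## The three bivector fields -/

/-- `⟨ξ₁, u₁⟩ + ⟨ξ₂, u₂⟩ + ⟨ξ₃, u₃⟩`. Through it, `ξ` in `su(2)³` stands for the covector
`dl¹_{ξ₁} + dl²_{ξ₂} + dl³_{ξ₃}`, where `l^j_ξ(a) = ⟨ξ, a_j⟩`; every covector is of this form. -/
noncomputable def pairing (c : ℝ) (ξ u : Triple) : ℝ := ∑ j, ip c (ξ j) (u j)

/-- The contraction with `ξ, ζ` of the symmetric tensor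
`A(a) = Φ⁻¹ ([a₁,a₂] ⊗ [a₁,a₂] + [a₂,a₃] ⊗ [a₂,a₃] + [a₃,a₁] ⊗ [a₃,a₁])`. -/
noncomputable def tensorA (c : ℝ) (a : Triple) (ξ ζ : su2) : ℝ :=
  (1 / Phi c a) * ∑ j : Fin 3, ip c ξ ⁅a j, a (j + 1)⁆ * ip c ζ ⁅a j, a (j + 1)⁆

/-- The values `{l^j_ξ, l^k_ζ}₁(a)` of the first Poisson bracket on linear functions
(the indices `0, 1, 2` stand for `1, 2, 3`). -/
noncomputable def linearBracket (c : ℝ) (a : Triple) (ξ ζ : su2) : Fin 3 → Fin 3 → ℝ :=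
  !![ip c ⁅ξ, ζ⁆ (a 0), ip c ⁅ξ, ζ⁆ (a 1), ip c ⁅ξ, ζ⁆ (a 2);
     ip c ⁅ξ, ζ⁆ (a 1), -ip c ⁅ξ, ζ⁆ (a 0), tensorA c a ξ ζ;
     ip c ⁅ξ, ζ⁆ (a 2), -tensorA c a ξ ζ, -ip c ⁅ξ, ζ⁆ (a 0)]

/-- The bivector field `π₁`, evaluated at the point `a` on the covectors `ξ, ζ`. -/
noncomputable def bivectorOne (c : ℝ) (a ξ ζ : Triple) : ℝ :=
  ∑ j, ∑ k, linearBracket c a (ξ j) (ζ k) j k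

/-- The inverse of the `m`-th power of the cyclic permutation `σ(a₁, a₂, a₃) = (a₃, a₁, a₂)`. -/
def cyclicInv (m : Fin 3) (a : Triple) : Triple := fun j => a (j + m)

/-- The bivector fields `π₁`, `π₂ = σ_* π₁`, `π₃ = σ_* π₂` (for `m = 0, 1, 2`). The map `σ`
preserves `pairing`, hence pulls the covector `ξ` back to the covector `σ⁻¹(ξ)`. -/
noncomputable def bivector (c : ℝ) (m : Fin 3) (a ξ ζ : Triple) : ℝ :=
  bivectorOne c (cyclicInv m a) (cyclicInv m ξ) (cyclicInv m ζ)

/-- `π♯(ξ) = u` for `π = π₁, π₂, π₃` (`m = 0, 1, 2`) at the point `a`, i.e.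
`ζ(u) = π(ξ, ζ)` for every covector `ζ`. -/
def IsSharp (c : ℝ) (m : Fin 3) (a ξ u : Triple) : Prop :=
  ∀ ζ : Triple, pairing c ζ u = bivector c m a ξ ζ

/-- The symplectic form that `π₁, π₂, π₃` (`m = 0, 1, 2`) induces on the symplectic leaf through
`a`, given by `ω(π♯(ξ), v) = ξ(v)`, i.e. `ω♭` inverts `π♯`. For `u, v` tangent to the leaf
(in the image of `π♯`) the value does not depend on the preimage `ξ` of `u`. -/
noncomputable def leafForm (c : ℝ) (m : Fin 3) (a u v : Triple) : ℝ :=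
  pairing c (Classical.epsilon fun ξ : Triple => IsSharp c m a ξ u) v

/-! ## The leaves `N_{q,r}` -/

/-- The leaf `N_{q,r}`. -/
def leaf (c q r : ℝ) : Set Triple :=
  {a | Phi c a < 0 ∧ (∀ i j, i ≠ j → ip c (a i) (a j) = 0) ∧
    ip c (a 0) (a 0) - ip c (a 1) (a 1) = q ∧ ip c (a 1) (a 1) - ip c (a 2) (a 2) = r}

open Classical in
/-- The type of `N_{q,r}`, for `q, r ≥ 0`. -/
noncomputable def leafType (q r : ℝ) : ℕ := if 0 < r then 2 else if 0 < q then 1 else 0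

/-! ## Isomorphisms of triples of 2-forms on submanifolds of a normed space -/

section Isomorphism

variable {E : Type*} [NormedAddCommGroup E] [NormedSpace ℝ E]

/-- The tangent space at `p` of a submanifold `M` of `E`: the velocities at `p` of curves in `M`
through `p`. (For a submanifold it is immaterial whether the curves are smooth everywhere or only
differentiable at that moment.) -/
def tangentVectors (M : Set E) (p : E) : Set E :=
  {u | ∃ γ : ℝ → E, γ 0 = p ∧ (∀ᶠ t in nhds 0, γ t ∈ M) ∧ HasDerivAt γ u 0}

/-- Smoothness of a map on a submanifold `M` of `E`: near every point of `M` it extends to a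
smooth map on an open subset of `E`. -/
def SmoothOnSubmanifold (F : E → E) (M : Set E) : Prop :=
  ∀ p ∈ M, ∃ U : Set E, IsOpen U ∧ p ∈ U ∧
    ∃ G : E → E, ContDiffOn ℝ ((⊤ : ℕ∞) : WithTop ℕ∞) G U ∧ Set.EqOn F G (M ∩ U)

/-- `F` restricts to a diffeomorphism of the submanifold `M` onto the submanifold `M'`. -/
def IsDiffeomorphismOn (F : E → E) (M M' : Set E) : Prop :=
  Set.BijOn F M M' ∧ SmoothOnSubmanifold F M ∧
    ∃ G : E → E, Set.InvOn G F M M' ∧ SmoothOnSubmanifold G M'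

/-- The hyperkähler manifolds `(M, ω₁, ω₂, ω₃)` and `(M', ω'₁, ω'₂, ω'₃)` are isomorphic: there are
a diffeomorphism `F : M → M'` and `O ∈ SO(3)` with `F^*(ω'₁, ω'₂, ω'₃) = (ω₁, ω₂, ω₃) O`. Here
`ω m p u v` is the value of the `m`-th form at the point `p` on the tangent vectors `u, v`. On
tangent vectors of `M`, `fderivWithin ℝ F M p` is the differential of `F : M → M'` at `p`. -/
def HyperkahlerIsomorphic (M : Set E) (ω : Fin 3 → E → E → E → ℝ)
    (M' : Set E) (ω' : Fin 3 → E → E → E → ℝ) : Prop :=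
  ∃ F : E → E, IsDiffeomorphismOn F M M' ∧
    ∃ O ∈ Matrix.specialOrthogonalGroup (Fin 3) ℝ,
      ∀ p ∈ M, ∀ u ∈ tangentVectors M p, ∀ v ∈ tangentVectors M p, ∀ k : Fin 3,
        ω' k (F p) (fderivWithin ℝ F M p u) (fderivWithin ℝ F M p v) =
          ∑ j, ω j p u v * O j k

end Isomorphism

open scoped RealInnerProductSpace Topology

/-! In Euclidean coordinates a leaf consists of the negatively oriented orthogonal frames with norms
`√(t + dᵢ)`, `d = (q + r, r, 0)`. It is a copy of `SO(3) × (0, ∞)` whose radial coordinate, the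
level, is `t = ‖a₃‖²`. With `τ = ⟨uᵢ, aᵢ⟩` and `mₖ = ⟨uₖ₊₁, aₖ₊₂⟩` the forms are `(τ ∧ mₖ - mₖ₊₁ ∧
mₖ₊₂) / Φ` (`leafForm_eq`), and up to a constant factor their metric is `(τ² + ∑ mₖ²) / |Φ|`. The
quaternion relations recover the metric from the forms, so an isomorphism is an isometry
(`transpose_mul_self_of_forms`, `speedSq_eq_of_forms`).

The end `t → 0` lies at finite distance and the end `t → ∞` at infinite distance. The distance to
the first end, `radialLength`, is therefore preserved (`SpeedIso.radialLength_level`). Hence level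
sets go to level sets and radial curves to radial curves (`SpeedIso.map_radial`), and the metrics on
the `SO(3)`-orbits correspond, with coefficients that do not depend on the level
(`SpeedIso.exists_orbitMetric_eq`).

As `t → 0`, the largest squared length of a rotation generator, `√((t + q + r)(t + r) / t)`, tends
to `∞` in type 2, to `√q > 0` in type 1 and to `0` in type 0. So the type cannot be larger on the
source (`SpeedIso.leafType_le`), and applying this to the inverse gives equality. -/

/-! ### Coordinates on `su(2)`: inner product, bracket and triple product. -/

theorem su2_entries (x : su2) : (x.1 0 0).re = 0 ∧ x.1 1 1 = - x.1 0 0 ∧ x.1 1 0 = - star (x.1 0 1) := by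
  obtain ⟨x, hx, ht⟩ := x
  have h00 := congrFun (congrFun hx 0) 0
  have h10 := congrFun (congrFun hx 1) 0
  simp only [Matrix.conjTranspose_apply, Matrix.neg_apply] at h00 h10
  refine ⟨?_, ?_, ?_⟩
  · have := congrArg Complex.re h00
    simp at this
    show (x 0 0).re = 0
    linarith
  · rw [Matrix.trace_fin_two] at ht
    show x 1 1 = - x 0 0
    linear_combination ht
  · show x 1 0 = - star (x 0 1)
    rw [h10, neg_neg]

/-- Coordinates in the basis `-iσₖ/2`. -/
def su2Coord (x : su2) : Fin 3 → ℝ := ![-2 * (x.1 0 1).im, -2 * (x.1 0 1).re, -2 * (x.1 0 0).im]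

theorem ip_eq_coord (c : ℝ) (x y : su2) :
    ip c x y = c / 2 * (su2Coord x 0 * su2Coord y 0 + su2Coord x 1 * su2Coord y 1
      + su2Coord x 2 * su2Coord y 2) := by
  obtain ⟨h1, h2, h3⟩ := su2_entries x
  obtain ⟨k1, k2, k3⟩ := su2_entries y
  simp [ip, su2Coord, Matrix.trace_fin_two, Matrix.mul_apply, Fin.sum_univ_two, h2, h3, k2, k3, h1, k1]
  ring

theorem su2Coord_lie (x y : su2) :
    su2Coord ⁅x, y⁆ = ![su2Coord x 1 * su2Coord y 2 - su2Coord x 2 * su2Coord y 1,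
      su2Coord x 2 * su2Coord y 0 - su2Coord x 0 * su2Coord y 2,
      su2Coord x 0 * su2Coord y 1 - su2Coord x 1 * su2Coord y 0] := by
  obtain ⟨h1, h2, h3⟩ := su2_entries x
  obtain ⟨k1, k2, k3⟩ := su2_entries y
  ext i
  fin_cases i <;>
  simp [su2Coord, LieSubalgebra.coe_bracket, Ring.lie_def, Matrix.mul_apply, Fin.sum_univ_two,
    h2, h3, k2, k3, h1, k1] <;> ring

/-- The coordinates as a linear equivalence. -/
noncomputable def su2EquivFun : su2 ≃ₗ[ℝ] (Fin 3 → ℝ) where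
  toFun := su2Coord
  map_add' x y := by ext i; fin_cases i <;> simp [su2Coord] <;> ring
  map_smul' t x := by ext i; fin_cases i <;> simp [su2Coord] <;> ring
  invFun v := ⟨!![⟨0, -v 2 / 2⟩, ⟨-v 1 / 2, -v 0 / 2⟩; ⟨v 1 / 2, -v 0 / 2⟩, ⟨0, v 2 / 2⟩], by
    constructor
    · ext i j
      fin_cases i <;> fin_cases j <;> apply Complex.ext <;> simp [neg_div]
    · rw [Matrix.trace_fin_two]; apply Complex.ext <;> simp [neg_div]⟩
  left_inv x := by
    obtain ⟨h1, h2, h3⟩ := su2_entries x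
    ext i j
    fin_cases i <;> fin_cases j <;> apply Complex.ext <;> simp [su2Coord, h1, h2, h3] <;> ring
  right_inv v := by
    ext i; fin_cases i <;> simp [su2Coord] <;> ring

/-- Coordinates on `su(2)` in which `ip c` is the Euclidean inner product. -/
noncomputable def su2Equiv (c : ℝ) (hc : 0 < c) : su2 ≃ₗ[ℝ] EuclideanSpace ℝ (Fin 3) :=
  su2EquivFun.trans ((LinearEquiv.smulOfNeZero ℝ (Fin 3 → ℝ) (√(c / 2)) (by positivity)).trans
    (WithLp.linearEquiv 2 ℝ (Fin 3 → ℝ)).symm)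

theorem su2Equiv_apply (c : ℝ) (hc : 0 < c) (x : su2) (i : Fin 3) :
    su2Equiv c hc x i = √(c / 2) * su2Coord x i := rfl

theorem inner_su2Equiv (c : ℝ) (hc : 0 < c) (x y : su2) :
    ⟪su2Equiv c hc x, su2Equiv c hc y⟫ = ip c x y := by
  have := Real.mul_self_sqrt (show 0 ≤ c / 2 by positivity)
  simp only [PiLp.inner_apply, Fin.sum_univ_three, su2Equiv_apply, ip_eq_coord]
  generalize √(c / 2) = k at this
  simp
  linear_combination (su2Coord x 0 * su2Coord y 0 + su2Coord x 1 * su2Coord y 1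
      + su2Coord x 2 * su2Coord y 2) * this

theorem ip_comm (c : ℝ) (x y : su2) : ip c x y = ip c y x := by
  rw [ip_eq_coord, ip_eq_coord]; ring

theorem ip_add_left (c : ℝ) (x y z : su2) : ip c (x + y) z = ip c x z + ip c y z := by
  simp [ip, add_mul]; ring

theorem ip_smul_left (c t : ℝ) (x z : su2) : ip c (t • x) z = t * ip c x z := by
  simp [ip]; ring

theorem ip_zero_left (c : ℝ) (z : su2) : ip c 0 z = 0 := by simp [ip]

/-- The triple product in coordinates. -/
theorem ip_lie_eq (c : ℝ) (x y z : su2) : ip c ⁅x, y⁆ z = c / 2 *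
    ((su2Coord x 1 * su2Coord y 2 - su2Coord x 2 * su2Coord y 1) * su2Coord z 0 +
      (su2Coord x 2 * su2Coord y 0 - su2Coord x 0 * su2Coord y 2) * su2Coord z 1 +
      (su2Coord x 0 * su2Coord y 1 - su2Coord x 1 * su2Coord y 0) * su2Coord z 2) := by
  rw [ip_eq_coord, su2Coord_lie]; simp

theorem ip_lie_left (c : ℝ) (x y z : su2) : ip c ⁅x, y⁆ z = ip c y ⁅z, x⁆ := by
  rw [ip_comm c y, ip_lie_eq, ip_lie_eq]; ring

theorem ip_lie_right_swap (c : ℝ) (x y z : su2) : ip c x ⁅y, z⁆ = - ip c x ⁅z, y⁆ := by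
  rw [ip_comm c x, ip_comm c x, ip_lie_eq, ip_lie_eq]; ring

/-- Cramer's rule: the brackets `[aᵢ₊₁, aᵢ₊₂]` divided by `Φ` form the basis dual to `a`. -/
theorem Phi_mul_ip (c : ℝ) (a : Triple) (z w : su2) :
    Phi c a * ip c z w = ip c w (a 0) * ip c z ⁅a 1, a 2⁆ + ip c w (a 1) * ip c z ⁅a 2, a 0⁆
      + ip c w (a 2) * ip c z ⁅a 0, a 1⁆ := by
  simp only [Phi, ip_comm c z ⁅_, _⁆, ip_comm c (a 0) ⁅_, _⁆, ip_lie_eq, ip_eq_coord c w, ip_eq_coord c z]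
  ring

/-! ### The symplectic forms on tangent vectors of a leaf. -/

/-- The linear relations satisfied by the tangent vectors `u` of the leaf through `a`. -/
structure TangentRel (c : ℝ) (a u : Triple) : Prop where
  diag : ∀ i j, ip c (u i) (a i) = ip c (u j) (a j)
  off : ∀ i j, i ≠ j → ip c (u i) (a j) = -ip c (u j) (a i)

/-- A covector `ξ` with `π₁♯(ξ) = u`, for `u` tangent to the leaf through `a`. -/
noncomputable def sharpPreimage (c : ℝ) (a u : Triple) : Triple :=
  ![(-1 / Phi c a) • (ip c (u 1) (a 2) • a 0 + ip c (u 2) (a 0) • a 1 + ip c (u 0) (a 1) • a 2),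
    (ip c (u 0) (a 0) / Phi c a) • a 2, 0]

theorem ip_lie_self_left (c : ℝ) (x y : su2) : ip c x ⁅x, y⁆ = 0 := by
  rw [ip_comm, ip_lie_eq]; ring

theorem ip_lie_self_right (c : ℝ) (x y : su2) : ip c x ⁅y, x⁆ = 0 := by
  rw [ip_comm, ip_lie_eq]; ring

theorem Phi_rotate (c : ℝ) (a : Triple) : ip c (a 2) ⁅a 0, a 1⁆ = Phi c a := by
  rw [Phi, ip_comm, ip_comm c (a 0), ip_lie_eq, ip_lie_eq]; ring

/-- Both sides are expanded in the dual basis by `Phi_mul_ip`. In `tensorA` only the term with `⟨a₃,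
[a₁, a₂]⟩ = Φ` survives, and it cancels the denominator. -/
theorem isSharp_sharpPreimage {c : ℝ} {a u : Triple} (ha : Phi c a ≠ 0) (h : TangentRel c a u) :
    IsSharp c 0 a (sharpPreimage c a u) u := by
  intro z
  have e0 := Phi_mul_ip c a (z 0) (u 0)
  have e1 := Phi_mul_ip c a (z 1) (u 1)
  have e2 := Phi_mul_ip c a (z 2) (u 2)
  rw [h.diag 1 0, h.off 1 0 (by decide)] at e1
  rw [h.diag 2 0, h.off 2 1 (by decide)] at e2
  rw [h.off 0 2 (by decide)] at e0
  have sw1 : ∀ x, ip c x ⁅a 1, a 0⁆ = -ip c x ⁅a 0, a 1⁆ := fun x => ip_lie_right_swap c x _ _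
  have sw2 : ∀ x, ip c x ⁅a 2, a 1⁆ = -ip c x ⁅a 1, a 2⁆ := fun x => ip_lie_right_swap c x _ _
  have sw3 : ∀ x, ip c x ⁅a 0, a 2⁆ = -ip c x ⁅a 2, a 0⁆ := fun x => ip_lie_right_swap c x _ _
  have hj : (2 : Fin 3) + 1 = 0 := rfl
  have hj' : (1 : Fin 3) + 1 = 2 := rfl
  have hcyc : ∀ b : Triple, cyclicInv 0 b = b := fun b => by ext; simp [cyclicInv]
  have self : ∀ x y : su2, ip c x ⁅y, y⁆ = 0 := fun x y => by rw [lie_self, ip_comm, ip_zero_left]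
  simp only [bivector, hcyc, bivectorOne, linearBracket, tensorA, pairing, Fin.sum_univ_three,
    sharpPreimage]
  simp only [Matrix.of_apply, Matrix.cons_val_zero, Matrix.cons_val_one, Matrix.cons_val,
    hj, hj', zero_add, ip_lie_left, lie_add, lie_smul, lie_zero]
  have lr : ∀ x y z : su2, ip c x (y + z) = ip c x y + ip c x z := fun x y z => by
    rw [ip_comm, ip_add_left, ip_comm c y, ip_comm c z]
  have sr : ∀ (t : ℝ) (x z : su2), ip c x (t • z) = t * ip c x z := fun t x z => by
    rw [ip_comm, ip_smul_left, ip_comm c z]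
  have zr : ∀ x, ip c x 0 = 0 := fun x => by rw [ip_comm, ip_zero_left]
  simp only [ip_smul_left, ip_zero_left, lr, sr, zr, sw1, sw2, sw3, self, ip_lie_self_left, ip_lie_self_right,
    Phi_rotate]
  apply mul_left_cancel₀ ha
  rw [mul_add, mul_add, e0, e1, e2]
  field_simp
  ring

theorem tensorA_comm (c : ℝ) (a : Triple) (x y : su2) : tensorA c a x y = tensorA c a y x := by
  simp only [tensorA]; congr 1; exact Finset.sum_congr rfl fun _ _ => mul_comm _ _

theorem bivectorOne_antisymm (c : ℝ) (a x y : Triple) : bivectorOne c a x y = -bivectorOne c a y x := by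
  have sw : ∀ (u v w : su2), ip c ⁅u, v⁆ w = -ip c ⁅v, u⁆ w := fun u v w => by
    rw [ip_comm, ip_lie_right_swap, ip_comm]
  simp only [bivectorOne, linearBracket, Fin.sum_univ_three]
  simp only [Matrix.of_apply, Matrix.cons_val_zero, Matrix.cons_val_one, Matrix.cons_val]
  rw [tensorA_comm c a (y 1), tensorA_comm c a (y 2)]
  simp only [sw (y _) (x _)]
  ring

theorem pairing_cyclicInv (c : ℝ) (m : Fin 3) (x y : Triple) :
    pairing c (cyclicInv m x) (cyclicInv m y) = pairing c x y :=
  Equiv.sum_comp (Equiv.addRight m) fun j => ip c (x j) (y j)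

theorem cyclicInv_neg_cyclicInv (m : Fin 3) (x : Triple) : cyclicInv m (cyclicInv (-m) x) = x := by
  ext1 j; simp [cyclicInv]

/-- Reduces `π₂` and `π₃` to `π₁`. -/
theorem isSharp_cyclicInv_iff (c : ℝ) (m : Fin 3) (a x u : Triple) :
    IsSharp c m a x u ↔ IsSharp c 0 (cyclicInv m a) (cyclicInv m x) (cyclicInv m u) := by
  have hcyc : ∀ b : Triple, cyclicInv 0 b = b := fun b => by ext; simp [cyclicInv]
  constructor
  · intro h z
    have := h (cyclicInv (-m) z)
    rw [← pairing_cyclicInv c m, bivector, cyclicInv_neg_cyclicInv] at this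
    rw [this, bivector, hcyc, hcyc, hcyc]
  · intro h z
    have := h (cyclicInv m z)
    rw [pairing_cyclicInv, bivector, hcyc, hcyc, hcyc] at this
    exact this

theorem Phi_cyclicInv (c : ℝ) (m : Fin 3) (a : Triple) : Phi c (cyclicInv m a) = Phi c a := by
  fin_cases m
  · simp [Phi, cyclicInv]
  · change ip c (a 1) ⁅a 2, a 0⁆ = ip c (a 0) ⁅a 1, a 2⁆
    rw [← ip_lie_left, ip_comm]; exact Phi_rotate c a
  · exact Phi_rotate c a

theorem TangentRel.cyclicInv {c : ℝ} {a u : Triple} (h : TangentRel c a u) (m : Fin 3) :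
    TangentRel c (cyclicInv m a) (cyclicInv m u) :=
  ⟨fun _ _ => h.diag _ _, fun _ _ hij => h.off _ _ fun e => hij (add_right_cancel e)⟩

theorem pairing_sharpPreimage {c : ℝ} {a u v : Triple} (hv : TangentRel c a v) :
    pairing c (sharpPreimage c a u) v = 1 / Phi c a *
      (ip c (u 0) (a 0) * ip c (v 1) (a 2) - ip c (u 1) (a 2) * ip c (v 0) (a 0) -
        (ip c (u 2) (a 0) * ip c (v 0) (a 1) - ip c (u 0) (a 1) * ip c (v 2) (a 0))) := by
  simp only [pairing, sharpPreimage, Fin.sum_univ_three]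
  simp only [Matrix.cons_val_zero, Matrix.cons_val_one, Matrix.cons_val, ip_smul_left, ip_add_left,
    ip_zero_left, ip_comm c (a _)]
  rw [hv.off 0 2 (by decide)]
  ring

/-- The symplectic forms in the coordinates `τ = ⟨uᵢ, aᵢ⟩` and `mₖ = ⟨uₖ₊₁, aₖ₊₂⟩`. -/
theorem leafForm_eq {c : ℝ} {a u v : Triple} (ha : Phi c a ≠ 0) (hu : TangentRel c a u)
    (hv : TangentRel c a v) (m : Fin 3) :
    leafForm c m a u v = 1 / Phi c a *
      (ip c (u 0) (a 0) * ip c (v (m + 1)) (a (m + 2)) -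
        ip c (u (m + 1)) (a (m + 2)) * ip c (v 0) (a 0) -
        (ip c (u (m + 2)) (a m) * ip c (v m) (a (m + 1)) -
          ip c (u m) (a (m + 1)) * ip c (v (m + 2)) (a m))) := by
  have ha' : Phi c (cyclicInv m a) ≠ 0 := by rwa [Phi_cyclicInv]
  have key : ∀ w, TangentRel c a w → IsSharp c m a
      (cyclicInv (-m) (sharpPreimage c (cyclicInv m a) (cyclicInv m w))) w := fun w hw => by
    rw [isSharp_cyclicInv_iff, cyclicInv_neg_cyclicInv]
    exact isSharp_sharpPreimage ha' (hw.cyclicInv m)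
  -- Of the chosen preimage of `u` only its defining property is known. Antisymmetry of `π` moves
  -- the computation to the explicit preimage of `v`.
  have h1 := Classical.epsilon_spec (p := fun x : Triple => IsSharp c m a x u) ⟨_, key u hu⟩
  rw [leafForm, key v hv, bivector, bivectorOne_antisymm]
  have h2 := h1 (cyclicInv (-m) (sharpPreimage c (cyclicInv m a) (cyclicInv m v)))
  rw [bivector] at h2
  rw [← h2, ← pairing_cyclicInv c m, cyclicInv_neg_cyclicInv, pairing_sharpPreimage (hu.cyclicInv m),
    Phi_cyclicInv]
  simp only [cyclicInv, zero_add]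
  rw [hu.diag m 0, hv.diag m 0, add_comm 1 m, add_comm 2 m]
  ring

/-! ### Quaternionic linear algebra: the metric is determined by the three forms. -/

/-- The matrices of the three standard symplectic forms `τ ∧ mₖ - mₖ₊₁ ∧ mₖ₊₂` on `ℝ⁴`. -/
def formMatrix : Fin 3 → Matrix (Fin 4) (Fin 4) ℝ :=
  ![!![0, 1, 0, 0; -1, 0, 0, 0; 0, 0, 0, -1; 0, 0, 1, 0],
    !![0, 0, 1, 0; 0, 0, 0, 1; -1, 0, 0, 0; 0, -1, 0, 0],
    !![0, 0, 0, 1; 0, 0, -1, 0; 0, 1, 0, 0; -1, 0, 0, 0]]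

theorem sum_smul_formMatrix (v : Fin 3 → ℝ) : ∑ j, v j • formMatrix j =
    !![0, v 0, v 1, v 2; -v 0, 0, -v 2, v 1; -v 1, v 2, 0, -v 0; -v 2, -v 1, v 0, 0] := by
  ext i j
  fin_cases i <;> fin_cases j <;> simp [formMatrix, Fin.sum_univ_three]

theorem sum_smul_formMatrix_mul_self (v : Fin 3 → ℝ) (h : v 0 ^ 2 + v 1 ^ 2 + v 2 ^ 2 = 1) :
    (∑ j, v j • formMatrix j) * (∑ j, v j • formMatrix j) = -1 := by
  rw [sum_smul_formMatrix]
  ext i j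
  fin_cases i <;> fin_cases j <;> simp [Matrix.mul_apply, Fin.sum_univ_four] <;>
    first | ring1 | linear_combination -h

/-- Multiplication of imaginary quaternions: for orthogonal vectors only the cross product remains.
-/
theorem sum_smul_formMatrix_mul (u v : Fin 3 → ℝ) (h : u 0 * v 0 + u 1 * v 1 + u 2 * v 2 = 0) :
    (∑ j, u j • formMatrix j) * (∑ j, v j • formMatrix j) =
      ∑ j, (![u 1 * v 2 - u 2 * v 1, u 2 * v 0 - u 0 * v 2, u 0 * v 1 - u 1 * v 0] : Fin 3 → ℝ) j •
        formMatrix j := by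
  simp only [sum_smul_formMatrix]
  ext i j
  fin_cases i <;> fin_cases j <;> simp [Matrix.mul_apply, Fin.sum_univ_four] <;>
    first | ring1 | linear_combination -h

theorem sum_smul_formMatrix_triple {O : Matrix (Fin 3) (Fin 3) ℝ}
    (hO : O ∈ Matrix.specialOrthogonalGroup (Fin 3) ℝ) :
    (∀ k, (∑ j, O j k • formMatrix j) * (∑ j, O j k • formMatrix j) = -1) ∧
    (∑ j, O j 0 • formMatrix j) * (∑ j, O j 1 • formMatrix j) * (∑ j, O j 2 • formMatrix j) = -1 := by
  obtain ⟨h1, h2⟩ := Matrix.mem_specialOrthogonalGroup_iff.1 hO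
  have h3 : O.transpose * O = 1 := (Matrix.mem_orthogonalGroup_iff' _ _).1 h1
  have hadj : O.adjugate = O.transpose := by
    have := congrArg (O.transpose * ·) (Matrix.mul_adjugate O)
    simpa [← mul_assoc, h3, h2] using this
  have he : ∀ k l, O 0 k * O 0 l + O 1 k * O 1 l + O 2 k * O 2 l = (1 : Matrix _ _ ℝ) k l := by
    intro k l
    rw [← h3, Matrix.mul_apply, Fin.sum_univ_three]; rfl
  have hs : ∀ k, (∑ j, O j k • formMatrix j) * (∑ j, O j k • formMatrix j) = -1 := fun k =>
    sum_smul_formMatrix_mul_self (fun j => O j k) (by have := he k k; simp at this; linarith)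
  refine ⟨hs, ?_⟩
  rw [sum_smul_formMatrix_mul (fun j => O j 0) (fun j => O j 1) (by simpa using he 0 1)]
  -- The first two columns of `O` have the third as their cross product. This is where `det O = 1`,
  -- rather than `±1`, enters.
  have hcol : (![O 1 0 * O 2 1 - O 2 0 * O 1 1, O 2 0 * O 0 1 - O 0 0 * O 2 1,
      O 0 0 * O 1 1 - O 1 0 * O 0 1] : Fin 3 → ℝ) = fun j => O j 2 := by
    ext j
    have := congrFun (congrFun hadj 2) j
    rw [Matrix.adjugate_fin_three, Matrix.transpose_apply] at this
    rw [← this]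
    fin_cases j <;> simp <;> ring
  rw [hcol, hs]

/-- With `Jₖ` the form matrices and `Kₖ = ∑ Oⱼₖ Jⱼ`, the product `(νK₀) K₁ (νK₂)` is evaluated
twice, using `J₀J₁J₂ = -1` and `K₀K₁K₂ = -1`. -/
theorem transpose_mul_self_of_forms {O : Matrix (Fin 3) (Fin 3) ℝ}
    (hO : O ∈ Matrix.specialOrthogonalGroup (Fin 3) ℝ) {A : Matrix (Fin 4) (Fin 4) ℝ} {ν : ℝ}
    (hν : ν ≠ 0)
    (h : ∀ k, A.transpose * formMatrix k * A = ν • ∑ j, O j k • formMatrix j) :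
    A.transpose * A = ν • (1 : Matrix (Fin 4) (Fin 4) ℝ) := by
  obtain ⟨hK, hK3⟩ := sum_smul_formMatrix_triple hO
  obtain ⟨hJ, hJ3⟩ := sum_smul_formMatrix_triple (one_mem (Matrix.specialOrthogonalGroup (Fin 3) ℝ))
  have hone : ∀ k, ∑ j, (1 : Matrix (Fin 3) (Fin 3) ℝ) j k • formMatrix j = formMatrix k := by
    intro k
    simp [Matrix.one_apply]
  simp only [hone] at hJ hJ3
  have h0 := h 0
  have h1 := h 1
  have h2 := h 2
  have hK1 := hK 1
  have hJ1 := hJ 1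
  generalize ∑ j, O j 0 • formMatrix j = K0 at *
  generalize ∑ j, O j 1 • formMatrix j = K1 at *
  generalize ∑ j, O j 2 • formMatrix j = K2 at *
  generalize formMatrix 0 = J0 at *
  generalize formMatrix 1 = J1 at *
  generalize formMatrix 2 = J2 at *
  generalize A.transpose = B at *
  -- A right inverse of the square matrix `Aᵀ`, hence also a left inverse. This turns `Aᵀ J₁ A = ν
  -- K₁` into `A K₁ Aᵀ = ν J₁`.
  have e1 : B * ((-ν⁻¹) • (J1 * A * K1)) = 1 := by
    rw [Matrix.mul_smul, ← mul_assoc, ← mul_assoc, h1, Matrix.smul_mul, hK1, smul_smul]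
    simp [hν]
  have e2 := mul_eq_one_comm.1 e1
  have e3 : A * K1 * B = ν • J1 := by
    have := congrArg (fun M => ν • (J1 * M)) e2
    simp only [Matrix.smul_mul, Matrix.mul_smul, smul_smul, mul_one] at this
    rw [← this, ← mul_assoc, ← mul_assoc, ← mul_assoc, hJ1]
    simp [hν]
  have e4 : (ν • K0) * K1 * (ν • K2) = -(ν • (B * A)) := by
    rw [← h0, ← h2]
    calc B * J0 * A * K1 * (B * J2 * A) = B * J0 * (A * K1 * B) * J2 * A := by noncomm_ring
      _ = ν • (B * (J0 * J1 * J2) * A) := by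
        rw [e3]; simp only [Matrix.smul_mul, Matrix.mul_smul, mul_assoc]
      _ = _ := by rw [hJ3]; simp
  have e5 : (ν • K0) * K1 * (ν • K2) = -(ν • (ν • (1 : Matrix (Fin 4) (Fin 4) ℝ))) := by
    rw [Matrix.smul_mul, Matrix.smul_mul, Matrix.mul_smul, hK3]; simp
  exact smul_right_injective _ hν (neg_injective (e4.symm.trans e5))

/-! ### Orthogonal frames and the leaves they form. -/

/-- Triples of vectors in Euclidean space. -/
abbrev Frame : Type := Fin 3 → EuclideanSpace ℝ (Fin 3)

/-- The determinant of a frame. -/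
noncomputable def frameDet (a : Frame) : ℝ := Matrix.det (Matrix.of fun i j => a i j)

/-- The negatively oriented orthogonal frames with `‖a i‖² = ‖a 2‖² + d i`. -/
def frameLeaf (d : Fin 3 → ℝ) : Set Frame :=
  {a | frameDet a < 0 ∧ (∀ i j, i ≠ j → ⟪a i, a j⟫ = 0) ∧ ∀ i, ‖a i‖ ^ 2 = ‖a 2‖ ^ 2 + d i}

/-- The Gram matrix of an orthogonal frame is diagonal. -/
theorem frameDet_sq {a : Frame} (h : ∀ i j, i ≠ j → ⟪a i, a j⟫ = 0) :
    frameDet a ^ 2 = ∏ i, ‖a i‖ ^ 2 := by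
  have : (Matrix.of fun i j => a i j) * (Matrix.of fun i j => a i j).transpose =
      Matrix.diagonal fun i => ‖a i‖ ^ 2 := by
    ext i j
    rw [Matrix.mul_apply]
    have e : ∑ k, Matrix.of (fun i j => a i j) i k * (Matrix.of fun i j => a i j).transpose k j
        = ⟪a j, a i⟫ := by
      simp [PiLp.inner_apply]
    rw [e]
    rcases eq_or_ne i j with rfl | hij
    · simp
    · rw [h j i hij.symm, Matrix.diagonal_apply_ne _ hij]
  have h2 := congrArg Matrix.det this
  rw [Matrix.det_mul, Matrix.det_transpose, Matrix.det_diagonal] at h2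
  rw [← h2, frameDet, sq]

theorem abs_frameDet {a : Frame} (h : ∀ i j, i ≠ j → ⟪a i, a j⟫ = 0) :
    |frameDet a| = ∏ i, ‖a i‖ := by
  rw [← Real.sqrt_sq_eq_abs, frameDet_sq h, Finset.prod_pow, Real.sqrt_sq (by positivity)]

theorem frameDet_smul (v : Fin 3 → ℝ) (a : Frame) :
    frameDet (fun i => v i • a i) = (∏ i, v i) * frameDet a :=
  Matrix.det_mul_column v _

theorem continuous_frameDet : Continuous frameDet := by
  unfold frameDet
  refine Continuous.matrix_det ?_
  refine continuous_matrix fun i j => ?_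
  simp only [Matrix.of_apply]
  fun_prop

theorem eq_zero_of_inner_frame {a : Frame} (ha : frameDet a ≠ 0) {v : EuclideanSpace ℝ (Fin 3)}
    (h : ∀ i, ⟪v, a i⟫ = 0) : v = 0 := by
  have : (Matrix.of fun i j => a i j).mulVec (WithLp.ofLp v) = 0 := by
    ext i
    refine Eq.trans ?_ (h i)
    simp [Matrix.mulVec, dotProduct, PiLp.inner_apply]
  have := Matrix.eq_zero_of_mulVec_eq_zero ha this
  ext i
  exact congrFun this i

namespace frameLeaf

variable {d : Fin 3 → ℝ} {a : Frame}

theorem norm_pos (ha : a ∈ frameLeaf d) (i : Fin 3) : 0 < ‖a i‖ := by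
  rw [norm_pos_iff]
  intro h
  have := ha.1
  rw [frameDet, Matrix.det_eq_zero_of_row_eq_zero i (by simp [h])] at this
  exact lt_irrefl _ this

theorem level_pos (ha : a ∈ frameLeaf d) : 0 < ‖a 2‖ ^ 2 := by
  have := norm_pos ha 2; positivity

theorem norm_eq (ha : a ∈ frameLeaf d) (i : Fin 3) : ‖a i‖ = √(‖a 2‖ ^ 2 + d i) := by
  rw [← ha.2.2 i, Real.sqrt_sq (norm_nonneg _)]

theorem smul_mem {v : Fin 3 → ℝ} {d' : Fin 3 → ℝ} (ha : a ∈ frameLeaf d) (hv : ∀ i, 0 < v i)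
    (h : ∀ i, (v i * ‖a i‖) ^ 2 = (v 2 * ‖a 2‖) ^ 2 + d' i) :
    (fun i => v i • a i) ∈ frameLeaf d' := by
  refine ⟨?_, ?_, ?_⟩
  · rw [frameDet_smul]
    exact mul_neg_of_pos_of_neg (Finset.prod_pos fun i _ => hv i) ha.1
  · intro i j hij
    rw [inner_smul_left, inner_smul_right, ha.2.1 i j hij]; simp
  · intro i
    simp only [norm_smul, Real.norm_eq_abs, abs_of_pos (hv _)]
    exact h i

end frameLeaf

/-! ### Radial curves, rotations and tangent vectors. -/

/-- Rescales a frame to level `t`, keeping the directions of its vectors. -/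
noncomputable def radial (d : Fin 3 → ℝ) (a : Frame) (t : ℝ) : Frame :=
  fun i => (√(t + d i) / ‖a i‖) • a i

theorem norm_radial {d : Fin 3 → ℝ} {a : Frame} (ha : a ∈ frameLeaf d) (t : ℝ) (i : Fin 3) :
    ‖radial d a t i‖ = √(t + d i) := by
  have := frameLeaf.norm_pos ha i
  rw [radial, norm_smul, Real.norm_eq_abs, abs_of_nonneg (by positivity)]
  field_simp

theorem level_radial {d : Fin 3 → ℝ} (hd2 : d 2 = 0) {a : Frame} (ha : a ∈ frameLeaf d) {t : ℝ}
    (ht : 0 ≤ t) : ‖radial d a t 2‖ ^ 2 = t := by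
  rw [norm_radial ha, hd2, add_zero, Real.sq_sqrt ht]

theorem radial_mem {d : Fin 3 → ℝ} (hd : ∀ i, 0 ≤ d i) (hd2 : d 2 = 0) {a : Frame}
    (ha : a ∈ frameLeaf d) {t : ℝ} (ht : 0 < t) : radial d a t ∈ frameLeaf d := by
  have hp := frameLeaf.norm_pos ha
  have hs : ∀ i, 0 < t + d i := fun i => add_pos_of_pos_of_nonneg ht (hd i)
  refine frameLeaf.smul_mem ha (fun i => div_pos (Real.sqrt_pos.2 (hs i)) (hp i)) fun i => ?_
  rw [div_mul_cancel₀ _ (hp i).ne', div_mul_cancel₀ _ (hp 2).ne', Real.sq_sqrt (hs i).le,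
    Real.sq_sqrt (hs 2).le, hd2, add_zero]

theorem radial_level {d : Fin 3 → ℝ} {a : Frame} (ha : a ∈ frameLeaf d) :
    radial d a (‖a 2‖ ^ 2) = a := by
  ext1 i
  rw [radial, ← frameLeaf.norm_eq ha, div_self (frameLeaf.norm_pos ha i).ne', one_smul]

theorem hasDerivAt_radial {d : Fin 3 → ℝ} (hd : ∀ i, 0 ≤ d i) (a : Frame) {t : ℝ} (ht : 0 < t) :
    HasDerivAt (radial d a) (fun i => (1 / (2 * √(t + d i)) / ‖a i‖) • a i) t := by
  rw [hasDerivAt_pi]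
  intro i
  have h := ((hasDerivAt_id t).add_const (d i)).sqrt (add_pos_of_pos_of_nonneg ht (hd i)).ne'
  exact (h.div_const ‖a i‖).smul_const (a i)

/-- The relations satisfied by velocities of curves in a leaf. -/
structure FrameTangent (a u : Frame) : Prop where
  diag : ∀ i j, ⟪u i, a i⟫ = ⟪u j, a j⟫
  off : ∀ i j, i ≠ j → ⟪u i, a j⟫ = -⟪u j, a i⟫

theorem HasDerivAt.inner_apply {γ : ℝ → Frame} {u : Frame} {t : ℝ} (h : HasDerivAt γ u t)
    (i j : Fin 3) : HasDerivAt (fun x => ⟪γ x i, γ x j⟫) (⟪u i, γ t j⟫ + ⟪u j, γ t i⟫) t := by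
  rw [hasDerivAt_pi] at h
  have := (h i).inner ℝ (h j)
  rw [add_comm, real_inner_comm (u j)] at this
  exact this

theorem HasDerivAt.level {γ : ℝ → Frame} {u : Frame} {t : ℝ} (h : HasDerivAt γ u t) (i : Fin 3) :
    HasDerivAt (fun x => ‖γ x i‖ ^ 2) (2 * ⟪u i, γ t i⟫) t := by
  have := h.inner_apply i i
  simp only [real_inner_self_eq_norm_sq] at this
  rwa [two_mul]

theorem FrameTangent.of_hasDerivAt {d : Fin 3 → ℝ} {γ : ℝ → Frame} {u : Frame} {t : ℝ}
    (h : HasDerivAt γ u t) (hγ : ∀ᶠ x in 𝓝 t, γ x ∈ frameLeaf d) : FrameTangent (γ t) u := by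
  have hdiag : ∀ i, ⟪u i, γ t i⟫ = ⟪u 2, γ t 2⟫ := by
    intro i
    have h1 := h.level i
    have h2 := (h.level 2).add_const (d i)
    have h3 := h1.congr_of_eventuallyEq (f₁ := fun x => ‖γ x 2‖ ^ 2 + d i)
      (hγ.mono fun x hx => (hx.2.2 i).symm)
    have := h3.unique h2
    linarith
  refine ⟨fun i j => (hdiag i).trans (hdiag j).symm, fun i j hij => ?_⟩
  have h1 := (h.inner_apply i j).congr_of_eventuallyEq (f₁ := fun _ => (0 : ℝ))
    (hγ.mono fun x hx => (hx.2.1 i j hij).symm)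
  have := h1.unique (hasDerivAt_const t (0 : ℝ))
  linarith

/-- The coordinates of a tangent vector. -/
noncomputable def tangentCoord (a u : Frame) : Fin 4 → ℝ :=
  ![⟪u 0, a 0⟫, ⟪u 1, a 2⟫, ⟪u 2, a 0⟫, ⟪u 0, a 1⟫]

theorem FrameTangent.eq_zero {a u : Frame} (ha : frameDet a ≠ 0) (h : FrameTangent a u)
    (hu : tangentCoord a u = 0) : u = 0 := by
  have h0 : ⟪u 0, a 0⟫ = 0 := congrFun hu 0
  have h1 : ⟪u 1, a 2⟫ = 0 := congrFun hu 1
  have h2 : ⟪u 2, a 0⟫ = 0 := congrFun hu 2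
  have h3 : ⟪u 0, a 1⟫ = 0 := congrFun hu 3
  ext1 i
  refine eq_zero_of_inner_frame ha fun j => ?_
  fin_cases i <;> fin_cases j
  · exact h0
  · exact h3
  · change ⟪u 0, a 2⟫ = 0
    rw [h.off 0 2 (by decide), h2, neg_zero]
  · change ⟪u 1, a 0⟫ = 0
    rw [h.off 1 0 (by decide), h3, neg_zero]
  · exact (h.diag 1 0).trans h0
  · exact h1
  · exact h2
  · change ⟪u 2, a 1⟫ = 0
    rw [h.off 2 1 (by decide), h1, neg_zero]
  · exact (h.diag 2 0).trans h0

theorem FrameTangent.add {a u v : Frame} (hu : FrameTangent a u) (hv : FrameTangent a v) :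
    FrameTangent a (u + v) :=
  ⟨fun i j => by simp only [Pi.add_apply, inner_add_left, hu.diag i j, hv.diag i j],
    fun i j hij => by simp only [Pi.add_apply, inner_add_left, hu.off i j hij, hv.off i j hij]; ring⟩

theorem FrameTangent.smul {a u : Frame} (hu : FrameTangent a u) (t : ℝ) :
    FrameTangent a (t • u) :=
  ⟨fun i j => by simp only [Pi.smul_apply, real_inner_smul_left, hu.diag i j],
    fun i j hij => by simp only [Pi.smul_apply, real_inner_smul_left, hu.off i j hij]; ring⟩

noncomputable def tangentCoordLinear (a : Frame) : Frame →ₗ[ℝ] (Fin 4 → ℝ) where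
  toFun := tangentCoord a
  map_add' u v := by ext i; fin_cases i <;> simp [tangentCoord, inner_add_left]
  map_smul' t u := by ext i; fin_cases i <;> simp [tangentCoord, inner_smul_left]

/-- Skew-symmetric maps applied to a frame are tangent to its leaf. -/
theorem exists_curve_skew {d : Fin 3 → ℝ} {a : Frame} (ha : a ∈ frameLeaf d)
    (S : EuclideanSpace ℝ (Fin 3) →L[ℝ] EuclideanSpace ℝ (Fin 3)) (hS : S ∈ skewAdjoint _) :
    ∃ γ : ℝ → Frame, γ 0 = a ∧ (∀ᶠ t in 𝓝 0, γ t ∈ frameLeaf d) ∧ (∀ t, ‖γ t 2‖ = ‖a 2‖) ∧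
      HasDerivAt γ (fun i => S (a i)) 0 := by
  let R : ℝ → (EuclideanSpace ℝ (Fin 3) →L[ℝ] EuclideanSpace ℝ (Fin 3)) :=
    fun t => NormedSpace.exp (t • S)
  have hinner : ∀ t x y, ⟪R t x, R t y⟫ = ⟪x, y⟫ := by
    intro t x y
    have h1 : R t ∈ unitary _ := by
      let : NormedAlgebra ℚ (EuclideanSpace ℝ (Fin 3) →L[ℝ] EuclideanSpace ℝ (Fin 3)) :=
        NormedAlgebra.restrictScalars ℚ ℝ _
      refine NormedSpace.exp_mem_unitary_of_mem_skewAdjoint ?_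
      exact skewAdjoint.smul_mem t hS
    have h2 := (Unitary.mem_iff.1 h1).1
    rw [ContinuousLinearMap.star_eq_adjoint] at h2
    rw [← ContinuousLinearMap.adjoint_inner_right, ← ContinuousLinearMap.comp_apply]
    have h3 := congrArg (fun T => T y) h2
    have h4 : (ContinuousLinearMap.adjoint (R t)) (R t y) = y := h3
    rw [ContinuousLinearMap.comp_apply, h4]
  have hnorm : ∀ t x, ‖R t x‖ = ‖x‖ := by
    intro t x
    have := hinner t x x
    rw [real_inner_self_eq_norm_sq, real_inner_self_eq_norm_sq] at this
    exact (sq_eq_sq₀ (norm_nonneg _) (norm_nonneg _)).1 this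
  have hR : HasDerivAt R S 0 := by
    have := hasDerivAt_exp_smul_const (𝕂 := ℝ) S (0 : ℝ)
    rwa [zero_smul ℝ S, NormedSpace.exp_zero, one_mul] at this
  have hR0 : R 0 = 1 := by simp only [R]; rw [zero_smul ℝ S, NormedSpace.exp_zero]
  have hd : HasDerivAt (fun t i => R t (a i)) (fun i => S (a i)) 0 := by
    rw [hasDerivAt_pi]
    intro i
    simpa using hR.clm_apply (hasDerivAt_const (0 : ℝ) (a i))
  refine ⟨fun t i => R t (a i), by simp [hR0], ?_, fun t => hnorm t _, hd⟩
  have hc : ContinuousAt (fun t => frameDet fun i => R t (a i)) 0 :=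
    continuous_frameDet.continuousAt.comp hd.continuousAt
  have : ∀ᶠ t in 𝓝 0, frameDet (fun i => R t (a i)) < 0 := by
    refine hc.eventually_lt continuousAt_const ?_
    simpa [hR0] using ha.1
  filter_upwards [this] with t ht
  exact ⟨ht, fun i j hij => by rw [hinner, ha.2.1 i j hij], fun i => by rw [hnorm, hnorm, ha.2.2 i]⟩

theorem exists_curve_rotation {d : Fin 3 → ℝ} {a : Frame} (ha : a ∈ frameLeaf d)
    (p q : EuclideanSpace ℝ (Fin 3)) :
    ∃ γ : ℝ → Frame, γ 0 = a ∧ (∀ᶠ t in 𝓝 0, γ t ∈ frameLeaf d) ∧ (∀ t, ‖γ t 2‖ = ‖a 2‖) ∧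
      HasDerivAt γ (fun i => ⟪p, a i⟫ • q - ⟪q, a i⟫ • p) 0 := by
  let S : EuclideanSpace ℝ (Fin 3) →L[ℝ] EuclideanSpace ℝ (Fin 3) :=
    (innerSL ℝ p).smulRight q - (innerSL ℝ q).smulRight p
  have hS : ∀ x, S x = ⟪p, x⟫ • q - ⟪q, x⟫ • p := fun x => by simp [S]
  have hskew : S ∈ skewAdjoint _ := by
    rw [skewAdjoint.mem_iff, ContinuousLinearMap.star_eq_adjoint, eq_comm,
      ContinuousLinearMap.eq_adjoint_iff]
    intro x y
    rw [neg_apply, hS, hS]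
    simp only [inner_neg_left, inner_sub_left, inner_sub_right, real_inner_smul_left,
      real_inner_smul_right, real_inner_comm p, real_inner_comm q]
    ring
  have := exists_curve_skew ha S hskew
  simpa only [hS] using this

/-- The tangent relations leave four coordinates. This realizes each basis vector by a curve in the
leaf, so that relations between forms can be tested on a full basis. -/
theorem exists_curve_tangentCoord {d : Fin 3 → ℝ} (hd : ∀ i, 0 ≤ d i) (hd2 : d 2 = 0) {a : Frame}
    (ha : a ∈ frameLeaf d) (i : Fin 4) :
    ∃ u : Frame, ∃ γ : ℝ → Frame, γ 0 = a ∧ (∀ᶠ t in 𝓝 0, γ t ∈ frameLeaf d) ∧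
      HasDerivAt γ u 0 ∧ tangentCoord a u = Pi.single i 1 := by
  have hrot : ∀ k l : Fin 3, ∃ u : Frame, (u = fun i => ⟪a k, a i⟫ • ((‖a k‖ ^ 2 * ‖a l‖ ^ 2)⁻¹ • a l)
      - ⟪(‖a k‖ ^ 2 * ‖a l‖ ^ 2)⁻¹ • a l, a i⟫ • a k) ∧ ∃ γ : ℝ → Frame, γ 0 = a ∧
      (∀ᶠ t in 𝓝 0, γ t ∈ frameLeaf d) ∧ HasDerivAt γ u 0 := by
    intro k l
    obtain ⟨γ, h1, h2, -, h3⟩ := exists_curve_rotation ha (a k) ((‖a k‖ ^ 2 * ‖a l‖ ^ 2)⁻¹ • a l)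
    exact ⟨_, rfl, γ, h1, h2, h3⟩
  have hn : ∀ i, ‖a i‖ ≠ 0 := fun i => (frameLeaf.norm_pos ha i).ne'
  have h01 := ha.2.1 0 1 (by decide)
  have h10 := ha.2.1 1 0 (by decide)
  have h02 := ha.2.1 0 2 (by decide)
  have h20 := ha.2.1 2 0 (by decide)
  have h12 := ha.2.1 1 2 (by decide)
  have h21 := ha.2.1 2 1 (by decide)
  have n0 := hn 0
  have n1 := hn 1
  have n2 := hn 2
  fin_cases i
  -- The level has derivative `2τ`, so it must grow at rate `2` to give `τ = 1`.
  · have h1 : HasDerivAt (fun t : ℝ => ‖a 2‖ ^ 2 + 2 * t) 2 0 := by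
      simpa using ((hasDerivAt_id (0 : ℝ)).const_mul 2).const_add (‖a 2‖ ^ 2)
    have h2 := hasDerivAt_radial hd a (t := ‖a 2‖ ^ 2 + 2 * 0)
      (by simpa using frameLeaf.level_pos ha)
    have h3 := HasDerivAt.scomp (g₁ := radial d a) (h := fun t : ℝ => ‖a 2‖ ^ 2 + 2 * t) (0 : ℝ) h2 h1
    refine ⟨_, fun t => radial d a (‖a 2‖ ^ 2 + 2 * t), ?_, ?_, h3, ?_⟩
    · simp only [mul_zero, add_zero]; exact radial_level ha
    · have : ∀ᶠ t in 𝓝 (0 : ℝ), 0 < ‖a 2‖ ^ 2 + 2 * t :=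
        continuousAt_const.eventually_lt h1.continuousAt
          (by rw [mul_zero, add_zero]; exact frameLeaf.level_pos ha)
      exact this.mono fun t ht => radial_mem hd hd2 ha ht
    · ext j
      fin_cases j <;>
        simp [tangentCoord, inner_smul_left, h01, h12, h20, ← frameLeaf.norm_eq ha]
      field_simp
  · obtain ⟨u, hu, γ, h⟩ := hrot 1 2
    refine ⟨u, γ, h.1, h.2.1, h.2.2, ?_⟩
    rw [hu]
    ext j
    fin_cases j <;>
      simp [tangentCoord, inner_smul_left, h12, h20, h10, h21]
    field_simp
  · obtain ⟨u, hu, γ, h⟩ := hrot 2 0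
    refine ⟨u, γ, h.1, h.2.1, h.2.2, ?_⟩
    rw [hu]
    ext j
    fin_cases j <;>
      simp [tangentCoord, inner_smul_left, h01, h20, h02, h21]
    field_simp
  · obtain ⟨u, hu, γ, h⟩ := hrot 0 1
    refine ⟨u, γ, h.1, h.2.1, h.2.2, ?_⟩
    rw [hu]
    ext j
    fin_cases j <;>
      simp [tangentCoord, inner_smul_left, h01, h12, h10, h02]
    field_simp

/-! ### The metric and its invariance. -/

/-- The square of the length of a tangent vector, in the metric of the hyperkähler structure. -/
noncomputable def speedSq (a u : Frame) : ℝ := (∑ i, tangentCoord a u i ^ 2) / ∏ i, ‖a i‖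

/-- In the bases dual to `tangentCoord`, `D` has a matrix `A` with `AᵀA = ν`, where `ν = frameDet b
/ frameDet a`. This factor compensates the change of the denominator in `speedSq`. -/
theorem speedSq_eq_of_forms {d d' : Fin 3 → ℝ} (hd : ∀ i, 0 ≤ d i) (hd2 : d 2 = 0) {a b : Frame}
    (ha : a ∈ frameLeaf d) (hb : b ∈ frameLeaf d') (D : Frame →ₗ[ℝ] Frame)
    {O : Matrix (Fin 3) (Fin 3) ℝ} (hO : O ∈ Matrix.specialOrthogonalGroup (Fin 3) ℝ)
    (h : ∀ u ∈ tangentVectors (frameLeaf d) a, ∀ v ∈ tangentVectors (frameLeaf d) a, ∀ k,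
      1 / frameDet b * (tangentCoord b (D u) ⬝ᵥ (formMatrix k).mulVec (tangentCoord b (D v))) =
      ∑ j, 1 / frameDet a * (tangentCoord a u ⬝ᵥ (formMatrix j).mulVec (tangentCoord a v)) * O j k)
    {u : Frame} (hu : FrameTangent a u) : speedSq b (D u) = speedSq a u := by
  choose e γ h0 hmem hder he using exists_curve_tangentCoord hd hd2 ha
  have het : ∀ i, FrameTangent a (e i) := fun i => by
    have := FrameTangent.of_hasDerivAt (hder i) (hmem i)
    rwa [h0] at this
  have hexp : u = ∑ i, tangentCoord a u i • e i := by
    rw [← sub_eq_zero]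
    refine FrameTangent.eq_zero ha.1.ne ?_ ?_
    · rw [sub_eq_add_neg, ← neg_one_smul ℝ]
      refine hu.add (FrameTangent.smul ?_ _)
      rw [Fin.sum_univ_four]
      exact ((((het 0).smul _).add ((het 1).smul _)).add ((het 2).smul _)).add ((het 3).smul _)
    · change tangentCoordLinear a _ = 0
      rw [map_sub, map_sum, sub_eq_zero]
      simp only [map_smul]
      change tangentCoord a u = ∑ i, tangentCoord a u i • tangentCoord a (e i)
      ext j
      simp [he, Finset.sum_apply, Pi.single_apply]
  let A : Matrix (Fin 4) (Fin 4) ℝ := Matrix.of fun r i => tangentCoord b (D (e i)) r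
  have hA : tangentCoord b (D u) = A.mulVec (tangentCoord a u) := by
    have h1 : tangentCoordLinear b (D u) =
        ∑ i, tangentCoord a u i • tangentCoordLinear b (D (e i)) := by
      conv_lhs => rw [hexp]
      simp only [map_sum, map_smul]
    ext r
    have h2 := congrFun h1 r
    rw [Finset.sum_apply] at h2
    refine h2.trans ?_
    simp only [Matrix.mulVec, dotProduct, A, Matrix.of_apply, Pi.smul_apply, smul_eq_mul]
    exact Finset.sum_congr rfl fun _ _ => mul_comm _ _
  have hAe : ∀ k i l, (A.transpose * formMatrix k * A) i l =
      tangentCoord b (D (e i)) ⬝ᵥ (formMatrix k).mulVec (tangentCoord b (D (e l))) := by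
    intro k i l
    rw [mul_assoc, Matrix.mul_apply]
    rfl
  have hν : frameDet b / frameDet a ≠ 0 := div_ne_zero hb.1.ne ha.1.ne
  have key := transpose_mul_self_of_forms hO (A := A) hν (fun k => by
    ext i l
    have h1 := h (e i) ⟨γ i, h0 i, hmem i, hder i⟩ (e l) ⟨γ l, h0 l, hmem l, hder l⟩ k
    have h2 : ∀ j, tangentCoord a (e i) ⬝ᵥ (formMatrix j).mulVec (tangentCoord a (e l)) =
        formMatrix j i l := fun j => by
      rw [he, he]; simp [Matrix.mulVec_single]
    rw [hAe]
    simp only [h2] at h1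
    have h3 : (∑ j, O j k • formMatrix j) i l = ∑ j, O j k * formMatrix j i l := by
      rw [Matrix.sum_apply]; rfl
    rw [Matrix.smul_apply, h3, smul_eq_mul]
    simp only [Fin.sum_univ_three] at h1 ⊢
    have hb' := hb.1.ne
    have ha' := ha.1.ne
    field_simp at h1 ⊢
    linear_combination h1)
  have hsq : ∑ i, tangentCoord b (D u) i ^ 2 =
      frameDet b / frameDet a * ∑ i, tangentCoord a u i ^ 2 := by
    have hdot : ∀ x : Fin 4 → ℝ, ∑ i, x i ^ 2 = x ⬝ᵥ x := fun x => by simp [dotProduct, sq]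
    rw [hdot, hdot, hA, Matrix.dotProduct_mulVec, Matrix.vecMul_mulVec, ← Matrix.dotProduct_mulVec,
      key, Matrix.smul_mulVec, Matrix.one_mulVec, dotProduct_smul, smul_eq_mul]
  rw [speedSq, speedSq, hsq, ← abs_frameDet ha.2.1, ← abs_frameDet hb.2.1, abs_of_neg ha.1,
    abs_of_neg hb.1]
  have hb' := hb.1.ne
  have ha' := ha.1.ne
  field_simp

/-! ### Distance to the end of a leaf. -/

/-- The speed of the radial curve in a leaf, parametrized by the level. -/
noncomputable def radialSpeed (d : Fin 3 → ℝ) (t : ℝ) : ℝ := 1 / (2 * √√(∏ i, (t + d i)))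

/-- The distance to the end of the leaf where the level tends to `0`. -/
noncomputable def radialLength (d : Fin 3 → ℝ) (s : ℝ) : ℝ := ∫ t in (0 : ℝ)..s, radialSpeed d t

section RadialLength

variable {d : Fin 3 → ℝ}

theorem radialSpeed_pos (hd : ∀ i, 0 ≤ d i) {t : ℝ} (ht : 0 < t) : 0 < radialSpeed d t := by
  have : 0 < ∏ i, (t + d i) := Finset.prod_pos fun i _ => add_pos_of_pos_of_nonneg ht (hd i)
  unfold radialSpeed
  positivity

/-- An integrable bound that puts the end `t → 0` at finite distance. -/
theorem radialSpeed_le (hd : ∀ i, 0 ≤ d i) {t : ℝ} (ht : 0 < t) :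
    radialSpeed d t ≤ 1 / 2 * t ^ (-3 / 4 : ℝ) := by
  have h1 : t ^ 3 ≤ ∏ i, (t + d i) := by
    rw [show t ^ 3 = ∏ _i : Fin 3, t by simp]
    exact Finset.prod_le_prod (fun _ _ => ht.le) fun i _ => le_add_of_nonneg_right (hd i)
  have h2 : √√(t ^ 3) = t ^ (3 / 4 : ℝ) := by
    rw [Real.sqrt_eq_rpow, Real.sqrt_eq_rpow, ← Real.rpow_natCast, ← Real.rpow_mul ht.le,
      ← Real.rpow_mul ht.le]
    norm_num
  have h3 : t ^ (3 / 4 : ℝ) ≤ √√(∏ i, (t + d i)) :=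
    h2 ▸ Real.sqrt_le_sqrt (Real.sqrt_le_sqrt h1)
  have h4 : 0 < t ^ (3 / 4 : ℝ) := by positivity
  rw [neg_div, Real.rpow_neg ht.le, radialSpeed, one_div, mul_inv, one_div]
  gcongr

theorem measurable_radialSpeed : Measurable (radialSpeed d) := by
  have : Measurable fun t : ℝ => ∏ i, (t + d i) := by
    refine Continuous.measurable ?_
    fun_prop
  exact (measurable_const.mul this.sqrt.sqrt).const_div _

theorem continuousAt_radialSpeed (hd : ∀ i, 0 ≤ d i) {t : ℝ} (ht : 0 < t) :
    ContinuousAt (radialSpeed d) t := by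
  have : 0 < ∏ i, (t + d i) := Finset.prod_pos fun i _ => add_pos_of_pos_of_nonneg ht (hd i)
  refine ContinuousAt.div continuousAt_const ?_ (by positivity)
  exact Continuous.continuousAt (by fun_prop)

theorem intervalIntegrable_bound (s : ℝ) :
    IntervalIntegrable (fun t : ℝ => 1 / 2 * t ^ (-3 / 4 : ℝ)) MeasureTheory.volume 0 s :=
  (intervalIntegral.intervalIntegrable_rpow' (by norm_num)).const_mul _

theorem intervalIntegrable_radialSpeed (hd : ∀ i, 0 ≤ d i) {s : ℝ} (hs : 0 ≤ s) :
    IntervalIntegrable (radialSpeed d) MeasureTheory.volume 0 s := by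
  refine (intervalIntegrable_bound s).mono_fun' measurable_radialSpeed.aestronglyMeasurable ?_
  rw [Set.uIoc_of_le hs]
  refine (MeasureTheory.ae_restrict_mem measurableSet_Ioc).mono fun t ht => ?_
  change ‖radialSpeed d t‖ ≤ _
  rw [Real.norm_eq_abs, abs_of_pos (radialSpeed_pos hd ht.1)]
  exact radialSpeed_le hd ht.1

theorem hasDerivAt_radialLength (hd : ∀ i, 0 ≤ d i) {s : ℝ} (hs : 0 < s) :
    HasDerivAt (radialLength d) (radialSpeed d s) s :=
  intervalIntegral.integral_hasDerivAt_right (intervalIntegrable_radialSpeed hd hs.le)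
    measurable_radialSpeed.stronglyMeasurable.stronglyMeasurableAtFilter
    (continuousAt_radialSpeed hd hs)

theorem radialLength_le (hd : ∀ i, 0 ≤ d i) {s : ℝ} (hs : 0 ≤ s) :
    radialLength d s ≤ 2 * s ^ (1 / 4 : ℝ) := by
  have h1 : ∫ t in (0 : ℝ)..s, 1 / 2 * t ^ (-3 / 4 : ℝ) = 2 * s ^ (1 / 4 : ℝ) := by
    rw [intervalIntegral.integral_const_mul, integral_rpow (Or.inl (by norm_num))]
    norm_num
    ring
  rw [← h1]
  exact intervalIntegral.integral_mono_on_of_le_Ioo hs (intervalIntegrable_radialSpeed hd hs)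
    (intervalIntegrable_bound s) fun t ht => radialSpeed_le hd ht.1

theorem radialLength_nonneg (hd : ∀ i, 0 ≤ d i) {s : ℝ} (hs : 0 ≤ s) : 0 ≤ radialLength d s := by
  have := intervalIntegral.integral_mono_on_of_le_Ioo hs (intervalIntegrable_const (c := (0 : ℝ)))
    (intervalIntegrable_radialSpeed hd hs) fun t ht => (radialSpeed_pos hd ht.1).le
  simpa [radialLength] using this

theorem strictMonoOn_radialLength (hd : ∀ i, 0 ≤ d i) :
    StrictMonoOn (radialLength d) (Set.Ioi 0) := by
  refine strictMonoOn_of_deriv_pos (convex_Ioi 0)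
    (fun t ht => (hasDerivAt_radialLength hd ht).continuousAt.continuousWithinAt) ?_
  intro t ht
  rw [interior_Ioi] at ht
  rw [(hasDerivAt_radialLength hd ht).deriv]
  exact radialSpeed_pos hd ht

/-- The end `t → ∞` is infinitely far away. -/
theorem exists_le_of_radialLength_le (hd : ∀ i, 0 ≤ d i) (C : ℝ) :
    ∃ K, ∀ s, 0 < s → radialLength d s ≤ C → s ≤ K := by
  obtain ⟨m, hm⟩ : ∃ m, ∀ i, d i ≤ m := ⟨∑ i, d i, fun i =>
    Finset.single_le_sum (fun j _ => hd j) (Finset.mem_univ i)⟩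
  -- The speed decreases, so `s * radialSpeed d s ≤ C`. For `s ≥ m` the product under the roots is
  -- at most `(2s)³`, so `radialSpeed d s ^ 4 ≥ 1 / (128 s³)` and `s ≤ 128 C⁴`.
  refine ⟨max (max m 0) (128 * C ^ 4), fun s hs hC => ?_⟩
  rcases le_total s (max m 0) with h | h
  · exact h.trans (le_max_left _ _)
  refine le_max_of_le_right ?_
  have hms : m ≤ s := (le_max_left _ _).trans h
  have hanti : ∀ t ∈ Set.Ioo 0 s, radialSpeed d s ≤ radialSpeed d t := by
    intro t ht
    have : 0 < ∏ i, (t + d i) := Finset.prod_pos fun i _ => add_pos_of_pos_of_nonneg ht.1 (hd i)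
    unfold radialSpeed
    have h2 : ∏ i, (t + d i) ≤ ∏ i, (s + d i) :=
      Finset.prod_le_prod (fun i _ => add_nonneg ht.1.le (hd i)) fun i _ => by linarith [ht.2]
    gcongr
  have h1 := intervalIntegral.integral_mono_on_of_le_Ioo hs.le
    (intervalIntegrable_const (c := radialSpeed d s)) (intervalIntegrable_radialSpeed hd hs.le) hanti
  rw [intervalIntegral.integral_const, smul_eq_mul, sub_zero] at h1
  have h2 : s * radialSpeed d s ≤ C := h1.trans hC
  have hP : 0 < ∏ i, (s + d i) := Finset.prod_pos fun i _ => add_pos_of_pos_of_nonneg hs (hd i)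
  have hP' : ∏ i, (s + d i) ≤ 8 * s ^ 3 := by
    refine (Finset.prod_le_prod (fun i _ => add_nonneg hs.le (hd i)) fun i _ =>
      show s + d i ≤ 2 * s by linarith [hm i]).trans (le_of_eq ?_)
    simp; ring
  have hr : radialSpeed d s ^ 4 * (16 * ∏ i, (s + d i)) = 1 := by
    have e : √√(∏ i, (s + d i)) ^ 4 = ∏ i, (s + d i) := by
      rw [show 4 = 2 * 2 by norm_num, pow_mul, Real.sq_sqrt (Real.sqrt_nonneg _), Real.sq_sqrt hP.le]
    rw [radialSpeed, div_pow, mul_pow, e]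
    field_simp
    norm_num
  have hpos := radialSpeed_pos hd hs
  have h3 : (s * radialSpeed d s) ^ 4 ≤ C ^ 4 := pow_le_pow_left₀ (by positivity) h2 4
  have h4 : s ^ 4 ≤ C ^ 4 * (128 * s ^ 3) := by
    calc s ^ 4 = (s * radialSpeed d s) ^ 4 * (16 * ∏ i, (s + d i)) := by
          rw [mul_pow, mul_assoc, hr, mul_one]
      _ ≤ C ^ 4 * (16 * (8 * s ^ 3)) := by gcongr
      _ = _ := by ring
  have h5 : 0 < s ^ 3 := by positivity
  refine le_of_mul_le_mul_right ?_ h5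
  linarith

end RadialLength

/-! ### Speed-preserving maps: levels and radial curves are preserved. -/

/-- Mutually inverse homeomorphisms between two sets of frames that map differentiable curves to
differentiable curves of the same speed. -/
structure SpeedIso (M M' : Set Frame) (F G : Frame → Frame) : Prop where
  mapsTo : Set.MapsTo F M M'
  mapsTo_inv : Set.MapsTo G M' M
  left_inv : Set.LeftInvOn G F M
  right_inv : Set.LeftInvOn F G M'
  cont : ContinuousOn F M
  cont_inv : ContinuousOn G M'
  speed : ∀ (γ : ℝ → Frame) (u : Frame) (t : ℝ), (∀ᶠ x in 𝓝 t, γ x ∈ M) → HasDerivAt γ u t →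
    ∃ w, HasDerivAt (fun x => F (γ x)) w t ∧ speedSq (F (γ t)) w = speedSq (γ t) u
  speed_inv : ∀ (γ : ℝ → Frame) (u : Frame) (t : ℝ), (∀ᶠ x in 𝓝 t, γ x ∈ M') → HasDerivAt γ u t →
    ∃ w, HasDerivAt (fun x => G (γ x)) w t ∧ speedSq (G (γ t)) w = speedSq (γ t) u

theorem SpeedIso.symm {M M' : Set Frame} {F G : Frame → Frame} (h : SpeedIso M M' F G) :
    SpeedIso M' M G F :=
  ⟨h.mapsTo_inv, h.mapsTo, h.right_inv, h.left_inv, h.cont_inv, h.cont, h.speed_inv, h.speed⟩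

theorem sqrt_prod_norm {d : Fin 3 → ℝ} {a : Frame} (ha : a ∈ frameLeaf d) :
    ∏ i, ‖a i‖ = √(∏ i, (‖a 2‖ ^ 2 + d i)) := by
  rw [show ∏ i, (‖a 2‖ ^ 2 + d i) = (∏ i, ‖a i‖) ^ 2 by
    rw [← Finset.prod_pow]; exact Finset.prod_congr rfl fun i _ => (ha.2.2 i).symm]
  rw [Real.sqrt_sq (by positivity)]

theorem radialSpeed_level_sq {d : Fin 3 → ℝ} {a : Frame} (ha : a ∈ frameLeaf d) :
    radialSpeed d (‖a 2‖ ^ 2) ^ 2 = 1 / (4 * ∏ i, ‖a i‖) := by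
  rw [radialSpeed, ← sqrt_prod_norm ha, div_pow, mul_pow,
    Real.sq_sqrt (Finset.prod_nonneg fun i _ => norm_nonneg _)]
  norm_num

theorem speedSq_radial {d : Fin 3 → ℝ} (hd : ∀ i, 0 ≤ d i) (hd2 : d 2 = 0) {a : Frame}
    (ha : a ∈ frameLeaf d) {t : ℝ} (ht : 0 < t) :
    speedSq (radial d a t) (fun i => (1 / (2 * √(t + d i)) / ‖a i‖) • a i) = radialSpeed d t ^ 2 := by
  have hm := radial_mem hd hd2 ha ht
  have h1 := radialSpeed_level_sq hm
  rw [level_radial hd2 ha ht.le] at h1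
  rw [h1, speedSq]
  have hs : 0 < √(t + d 0) := Real.sqrt_pos.2 (add_pos_of_pos_of_nonneg ht (hd 0))
  have hn := frameLeaf.norm_pos ha 0
  have h01 := ha.2.1 0 1 (by decide)
  have h20 := ha.2.1 2 0 (by decide)
  have h12 := ha.2.1 1 2 (by decide)
  have e : ∑ i, tangentCoord (radial d a t) (fun i => (1 / (2 * √(t + d i)) / ‖a i‖) • a i) i ^ 2
      = 1 / 4 := by
    simp [Fin.sum_univ_four, tangentCoord, radial, inner_smul_left, inner_smul_right, h01, h20, h12]
    field_simp
    norm_num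
  rw [e]
  field_simp

/-- The strict inequality `frameDet < 0` may be relaxed to `≤ 0`: a level at least `ε` keeps the
determinant away from `0`. -/
theorem isCompact_frameLeaf_inter {d : Fin 3 → ℝ} (hd : ∀ i, 0 ≤ d i) {ε : ℝ} (hε : 0 < ε) (K : ℝ) :
    IsCompact {a ∈ frameLeaf d | ε ≤ ‖a 2‖ ^ 2 ∧ ‖a 2‖ ^ 2 ≤ K} := by
  have heq : {a ∈ frameLeaf d | ε ≤ ‖a 2‖ ^ 2 ∧ ‖a 2‖ ^ 2 ≤ K} =
      {a | frameDet a ≤ 0} ∩ ({a | ∀ i j, i ≠ j → ⟪a i, a j⟫ = 0} ∩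
        ({a | ∀ i, ‖a i‖ ^ 2 = ‖a 2‖ ^ 2 + d i} ∩
          ({a | ε ≤ ‖a 2‖ ^ 2} ∩ {a | ‖a 2‖ ^ 2 ≤ K}))) := by
    ext a
    constructor
    · rintro ⟨⟨h1, h2, h3⟩, h4, h5⟩
      exact ⟨h1.le, h2, h3, h4, h5⟩
    · rintro ⟨h1, h2, h3, h4, h5⟩
      refine ⟨⟨lt_of_le_of_ne h1 ?_, h2, h3⟩, h4, h5⟩
      intro h0
      have hsq := frameDet_sq h2
      have : 0 < ∏ i, ‖a i‖ ^ 2 := Finset.prod_pos fun i _ => by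
        have h4' : ε ≤ ‖a 2‖ ^ 2 := h4
        have := h3 i
        have := hd i
        linarith
      rw [h0] at hsq
      norm_num at hsq
      linarith
  refine Metric.isCompact_of_isClosed_isBounded ?_ ?_
  · rw [heq]
    refine (isClosed_le continuous_frameDet continuous_const).inter (.inter ?_ (.inter ?_
      (.inter (isClosed_le continuous_const ?_) (isClosed_le ?_ continuous_const))))
    · simp only [Set.ofPred_forall]
      exact isClosed_iInter fun i => isClosed_iInter fun j => isClosed_iInter fun _ =>
        isClosed_eq (by fun_prop) continuous_const
    · simp only [Set.ofPred_forall]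
      exact isClosed_iInter fun i => isClosed_eq (by fun_prop) (by fun_prop)
    · fun_prop
    · fun_prop
  · refine (Metric.isBounded_closedBall (x := (0 : Frame)) (r := √(K + ∑ i, d i))).subset ?_
    rintro a ⟨ha, -, hK⟩
    rw [mem_closedBall_zero_iff, pi_norm_le_iff_of_nonneg (Real.sqrt_nonneg _)]
    intro i
    rw [frameLeaf.norm_eq ha i]
    exact Real.sqrt_le_sqrt (add_le_add hK
      (Finset.single_le_sum (fun j _ => hd j) (Finset.mem_univ i)))

namespace SpeedIso

variable {d d' : Fin 3 → ℝ} {F G : Frame → Frame}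

/-- Pythagoras for the image of a radial curve: its radial velocity and its rotational velocity are
orthogonal, and their squares add up to the squared speed of the original curve. -/
theorem exists_hasDerivAt_radial (h : SpeedIso (frameLeaf d) (frameLeaf d') F G)
    (hd : ∀ i, 0 ≤ d i) (hd2 : d 2 = 0) (hd' : ∀ i, 0 ≤ d' i) {a : Frame} (ha : a ∈ frameLeaf d)
    {t : ℝ} (ht : 0 < t) :
    ∃ w, HasDerivAt (fun x => F (radial d a x)) w t ∧ FrameTangent (F (radial d a t)) w ∧
      HasDerivAt (fun x => radialLength d' (‖F (radial d a x) 2‖ ^ 2))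
        (radialSpeed d' (‖F (radial d a t) 2‖ ^ 2) * (2 * ⟪w 0, F (radial d a t) 0⟫)) t ∧
      (radialSpeed d' (‖F (radial d a t) 2‖ ^ 2) * (2 * ⟪w 0, F (radial d a t) 0⟫)) ^ 2 +
        (tangentCoord (F (radial d a t)) w 1 ^ 2 + tangentCoord (F (radial d a t)) w 2 ^ 2 +
          tangentCoord (F (radial d a t)) w 3 ^ 2) / ∏ i, ‖F (radial d a t) i‖ =
        radialSpeed d t ^ 2 := by
  have hev : ∀ᶠ x in 𝓝 t, radial d a x ∈ frameLeaf d :=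
    (lt_mem_nhds ht).mono fun x hx => radial_mem hd hd2 ha hx
  obtain ⟨w, hw, hs⟩ := h.speed _ _ t hev (hasDerivAt_radial hd a ht)
  have hb := h.mapsTo (radial_mem hd hd2 ha ht)
  have hT : FrameTangent (F (radial d a t)) w :=
    FrameTangent.of_hasDerivAt hw (hev.mono fun x hx => h.mapsTo hx)
  refine ⟨w, hw, hT, ?_, ?_⟩
  · have h1 := hw.level 2
    rw [hT.diag 2 0] at h1
    exact HasDerivAt.comp t (hasDerivAt_radialLength hd' (frameLeaf.level_pos hb)) h1
  · rw [speedSq_radial hd hd2 ha ht] at hs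
    rw [← hs, mul_pow, radialSpeed_level_sq hb, speedSq, Fin.sum_univ_four]
    have : (tangentCoord (F (radial d a t)) w 0) = ⟪w 0, F (radial d a t) 0⟫ := rfl
    rw [this]
    have hp : 0 < ∏ i, ‖F (radial d a t) i‖ :=
      Finset.prod_pos fun i _ => frameLeaf.norm_pos hb i
    field_simp
    ring

end SpeedIso

namespace SpeedIso

variable {d d' : Fin 3 → ℝ} {F G : Frame → Frame}

/-- The image of a radial curve, from the end up to level `s`, is no longer than the curve. -/
theorem antitoneOn_and_monotoneOn (h : SpeedIso (frameLeaf d) (frameLeaf d') F G)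
    (hd : ∀ i, 0 ≤ d i) (hd2 : d 2 = 0) (hd' : ∀ i, 0 ≤ d' i) {a : Frame} (ha : a ∈ frameLeaf d) :
    AntitoneOn (fun t => radialLength d' (‖F (radial d a t) 2‖ ^ 2) - radialLength d t)
      (Set.Ioi 0) ∧
    MonotoneOn (fun t => radialLength d' (‖F (radial d a t) 2‖ ^ 2) + radialLength d t)
      (Set.Ioi 0) := by
  have key : ∀ t : ℝ, 0 < t → ∃ x, HasDerivAt
      (fun x => radialLength d' (‖F (radial d a x) 2‖ ^ 2)) x t ∧ |x| ≤ radialSpeed d t := by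
    intro t ht
    obtain ⟨w, -, -, h1, h2⟩ := h.exists_hasDerivAt_radial hd hd2 hd' ha ht
    -- Dropping the rotational part shows that `radialLength` changes no faster than arc length.
    refine ⟨_, h1, abs_le_of_sq_le_sq ?_ (radialSpeed_pos hd ht).le⟩
    rw [← h2]
    refine le_add_of_nonneg_right (div_nonneg (by positivity)
      (Finset.prod_nonneg fun i _ => norm_nonneg _))
  constructor
  · refine antitoneOn_of_deriv_nonpos (convex_Ioi 0) ?_ ?_ ?_
    · intro t ht
      obtain ⟨x, hx, -⟩ := key t ht
      exact (hx.sub (hasDerivAt_radialLength hd ht)).continuousAt.continuousWithinAt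
    · intro t ht
      rw [interior_Ioi] at ht
      obtain ⟨x, hx, -⟩ := key t ht
      exact (hx.sub (hasDerivAt_radialLength hd ht)).differentiableAt.differentiableWithinAt
    · intro t ht
      rw [interior_Ioi] at ht
      obtain ⟨x, hx, hx'⟩ := key t ht
      refine (HasDerivAt.deriv (hx.sub (hasDerivAt_radialLength hd ht))).trans_le ?_
      linarith [abs_le.1 hx']
  · refine monotoneOn_of_deriv_nonneg (convex_Ioi 0) ?_ ?_ ?_
    · intro t ht
      obtain ⟨x, hx, -⟩ := key t ht
      exact (hx.add (hasDerivAt_radialLength hd ht)).continuousAt.continuousWithinAt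
    · intro t ht
      rw [interior_Ioi] at ht
      obtain ⟨x, hx, -⟩ := key t ht
      exact (hx.add (hasDerivAt_radialLength hd ht)).differentiableAt.differentiableWithinAt
    · intro t ht
      rw [interior_Ioi] at ht
      obtain ⟨x, hx, hx'⟩ := key t ht
      refine le_of_le_of_eq ?_ (HasDerivAt.deriv (hx.add (hasDerivAt_radialLength hd ht))).symm
      linarith [abs_le.1 hx']

/-- If the image stayed at level at least `ε`, it would lie in a compact part of the target leaf, on
which the level of `G` has a positive lower bound `m`. But `G` takes the image back to level `t`,
which is below `m` for small `t`. -/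
theorem tendsto_level (h : SpeedIso (frameLeaf d) (frameLeaf d') F G)
    (hd : ∀ i, 0 ≤ d i) (hd2 : d 2 = 0) (hd' : ∀ i, 0 ≤ d' i) {a : Frame} (ha : a ∈ frameLeaf d) :
    Filter.Tendsto (fun t => ‖F (radial d a t) 2‖ ^ 2) (𝓝[>] 0) (𝓝 0) := by
  obtain ⟨K, hK⟩ := exists_le_of_radialLength_le hd'
    (radialLength d' (‖F (radial d a 1) 2‖ ^ 2) + radialLength d 1)
  have hmem : ∀ t : ℝ, 0 < t → F (radial d a t) ∈ frameLeaf d' := fun t ht =>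
    h.mapsTo (radial_mem hd hd2 ha ht)
  have hbound : ∀ t : ℝ, 0 < t → t ≤ 1 → ‖F (radial d a t) 2‖ ^ 2 ≤ K := by
    intro t ht ht1
    refine hK _ (frameLeaf.level_pos (hmem t ht)) ?_
    have h1 := (h.antitoneOn_and_monotoneOn hd hd2 hd' ha).2 (Set.mem_Ioi.2 ht)
      (Set.mem_Ioi.2 one_pos) ht1
    have h2 := radialLength_nonneg hd ht.le
    simp only at h1
    linarith
  rw [Metric.tendsto_nhds]
  intro ε hε
  have hcomp := isCompact_frameLeaf_inter hd' hε K
  have hcont : ContinuousOn (fun b => ‖G b 2‖ ^ 2)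
      {a ∈ frameLeaf d' | ε ≤ ‖a 2‖ ^ 2 ∧ ‖a 2‖ ^ 2 ≤ K} := by
    have h1 : ContinuousOn G {a ∈ frameLeaf d' | ε ≤ ‖a 2‖ ^ 2 ∧ ‖a 2‖ ^ 2 ≤ K} :=
      h.cont_inv.mono fun b hb => hb.1
    exact Continuous.comp_continuousOn (g := fun c : Frame => ‖c 2‖ ^ 2) (by fun_prop) h1
  obtain ⟨m, hm, hm'⟩ := hcomp.exists_forall_le' hcont (a := 0)
    fun b hb => frameLeaf.level_pos (h.mapsTo_inv hb.1)
  filter_upwards [Ioo_mem_nhdsGT (lt_min hm one_pos)] with t ht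
  rw [Real.dist_eq, sub_zero, abs_of_nonneg (by positivity)]
  by_contra! hlt
  have h1 := hm' (F (radial d a t))
    ⟨hmem t ht.1, hlt, hbound t ht.1 (ht.2.le.trans (min_le_right _ _))⟩
  rw [h.left_inv (radial_mem hd hd2 ha ht.1), level_radial hd2 ha ht.1.le] at h1
  exact absurd (ht.2.trans_le (min_le_left _ _)) h1.not_gt

/-- The image of the radial curve through `a` runs into the end `t → 0` and is no longer than the
curve itself. -/
theorem radialLength_level_le (h : SpeedIso (frameLeaf d) (frameLeaf d') F G)
    (hd : ∀ i, 0 ≤ d i) (hd2 : d 2 = 0) (hd' : ∀ i, 0 ≤ d' i) {a : Frame} (ha : a ∈ frameLeaf d) :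
    radialLength d' (‖F a 2‖ ^ 2) ≤ radialLength d (‖a 2‖ ^ 2) := by
  have hlim : Filter.Tendsto (fun t => 2 * (‖F (radial d a t) 2‖ ^ 2) ^ (1 / 4 : ℝ)) (𝓝[>] 0)
      (𝓝 0) := by
    have := ((h.tendsto_level hd hd2 hd' ha).rpow_const
      (p := 1 / 4) (Or.inr (by norm_num))).const_mul 2
    simpa using this
  have hs := frameLeaf.level_pos ha
  rw [← sub_nonpos]
  refine ge_of_tendsto hlim ?_
  filter_upwards [Ioo_mem_nhdsGT hs] with t ht
  have h1 := (h.antitoneOn_and_monotoneOn hd hd2 hd' ha).1 (Set.mem_Ioi.2 ht.1)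
    (Set.mem_Ioi.2 hs) ht.2.le
  simp only [radial_level ha] at h1
  have h2 := radialLength_nonneg hd ht.1.le
  have h3 := radialLength_le hd' (s := ‖F (radial d a t) 2‖ ^ 2) (by positivity)
  linarith

theorem radialLength_level (h : SpeedIso (frameLeaf d) (frameLeaf d') F G)
    (hd : ∀ i, 0 ≤ d i) (hd2 : d 2 = 0) (hd' : ∀ i, 0 ≤ d' i) (hd2' : d' 2 = 0) {a : Frame}
    (ha : a ∈ frameLeaf d) :
    radialLength d' (‖F a 2‖ ^ 2) = radialLength d (‖a 2‖ ^ 2) := by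
  refine le_antisymm (h.radialLength_level_le hd hd2 hd' ha) ?_
  have := h.symm.radialLength_level_le hd' hd2' hd (h.mapsTo ha)
  rwa [h.left_inv ha] at this

/-- The level of the image of a frame depends only on its level. -/
theorem level_congr (h : SpeedIso (frameLeaf d) (frameLeaf d') F G)
    (hd : ∀ i, 0 ≤ d i) (hd2 : d 2 = 0) (hd' : ∀ i, 0 ≤ d' i) (hd2' : d' 2 = 0) {a b : Frame}
    (ha : a ∈ frameLeaf d) (hb : b ∈ frameLeaf d) (hab : ‖a 2‖ = ‖b 2‖) :
    ‖F a 2‖ = ‖F b 2‖ := by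
  have h1 := h.radialLength_level hd hd2 hd' hd2' ha
  have h2 := h.radialLength_level hd hd2 hd' hd2' hb
  rw [hab, ← h2] at h1
  have h3 := (strictMonoOn_radialLength hd').injOn (frameLeaf.level_pos (h.mapsTo ha))
    (frameLeaf.level_pos (h.mapsTo hb)) h1
  exact (sq_eq_sq₀ (norm_nonneg _) (norm_nonneg _)).1 h3

/-- A tangent vector without components in the directions of rotations. -/
theorem _root_.FrameTangent.eq_smul {a w : Frame} (ha : a ∈ frameLeaf d) (hw : FrameTangent a w)
    (h1 : tangentCoord a w 1 = 0) (h2 : tangentCoord a w 2 = 0) (h3 : tangentCoord a w 3 = 0)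
    (i : Fin 3) : w i = (⟪w i, a i⟫ / ‖a i‖ ^ 2) • a i := by
  have e1 : ⟪w 1, a 2⟫ = 0 := h1
  have e2 : ⟪w 2, a 0⟫ = 0 := h2
  have e3 : ⟪w 0, a 1⟫ = 0 := h3
  have hoff : ∀ i j, i ≠ j → ⟪w i, a j⟫ = 0 := by
    intro i j hij
    have f1 := hw.off 2 1 (by decide)
    have f2 := hw.off 0 2 (by decide)
    have f3 := hw.off 1 0 (by decide)
    rw [e1, neg_zero] at f1
    rw [e2, neg_zero] at f2
    rw [e3, neg_zero] at f3
    fin_cases i <;> fin_cases j <;> first | exact absurd rfl hij | assumption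
  rw [← sub_eq_zero]
  refine eq_zero_of_inner_frame ha.1.ne fun j => ?_
  rw [inner_sub_left, real_inner_smul_left]
  rcases eq_or_ne i j with rfl | hij
  · have := (frameLeaf.norm_pos ha i).ne'
    rw [real_inner_self_eq_norm_sq]
    field_simp
    ring
  · rw [hoff i j hij, ha.2.1 i j hij]; simp

/-- Radial curves are mapped to radial curves. -/
theorem map_radial (h : SpeedIso (frameLeaf d) (frameLeaf d') F G)
    (hd : ∀ i, 0 ≤ d i) (hd2 : d 2 = 0) (hd' : ∀ i, 0 ≤ d' i) (hd2' : d' 2 = 0) {a : Frame}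
    (ha : a ∈ frameLeaf d) {t : ℝ} (ht : 0 < t) :
    F (radial d a t) = radial d' (F a) (‖F (radial d a t) 2‖ ^ 2) := by
  have hmem : ∀ t : ℝ, 0 < t → F (radial d a t) ∈ frameLeaf d' := fun t ht =>
    h.mapsTo (radial_mem hd hd2 ha ht)
  have hlen : ∀ t : ℝ, 0 < t → radialLength d' (‖F (radial d a t) 2‖ ^ 2) = radialLength d t := by
    intro t ht
    rw [h.radialLength_level hd hd2 hd' hd2' (radial_mem hd hd2 ha ht), level_radial hd2 ha ht.le]
  -- The unit directions of the image frame do not change along the curve.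
  have hder : ∀ i, ∀ t : ℝ, 0 < t →
      HasDerivAt (fun t => ‖F (radial d a t) i‖⁻¹ • F (radial d a t) i) 0 t := by
    intro i t ht
    obtain ⟨w, hw, hT, h1, h2⟩ := h.exists_hasDerivAt_radial hd hd2 hd' ha ht
    -- Since `radialLength` is preserved, the radial part already accounts for the full speed, and
    -- the rotational part vanishes.
    have h3 := (hasDerivAt_radialLength hd ht).congr_of_eventuallyEq
      ((lt_mem_nhds ht).mono fun x hx => hlen x hx)
    rw [h1.unique h3, add_eq_left, div_eq_zero_iff] at h2
    have hb := hmem t ht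
    have hprod : ∏ i, ‖F (radial d a t) i‖ ≠ 0 :=
      (Finset.prod_pos fun i _ => frameLeaf.norm_pos hb i).ne'
    have h4 := h2.resolve_right hprod
    have c1 : tangentCoord (F (radial d a t)) w 1 = 0 := by
      refine pow_eq_zero_iff two_ne_zero |>.1 (le_antisymm ?_ (sq_nonneg _)); nlinarith
    have c2 : tangentCoord (F (radial d a t)) w 2 = 0 := by
      refine pow_eq_zero_iff two_ne_zero |>.1 (le_antisymm ?_ (sq_nonneg _)); nlinarith
    have c3 : tangentCoord (F (radial d a t)) w 3 = 0 := by
      refine pow_eq_zero_iff two_ne_zero |>.1 (le_antisymm ?_ (sq_nonneg _)); nlinarith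
    have hwi := hT.eq_smul hb c1 c2 c3 i
    have hni := (frameLeaf.norm_pos hb i).ne'
    have hnorm : HasDerivAt (fun t => ‖F (radial d a t) i‖)
        (⟪w i, F (radial d a t) i⟫ / ‖F (radial d a t) i‖) t := by
      have e := (hw.level i).sqrt (pow_ne_zero 2 hni)
      simp only [Real.sqrt_sq (norm_nonneg _)] at e
      rwa [mul_div_mul_left _ _ two_ne_zero] at e
    have hz : ‖F (radial d a t) i‖⁻¹ • w i + (-(⟪w i, F (radial d a t) i⟫ / ‖F (radial d a t) i‖) /
        ‖F (radial d a t) i‖ ^ 2) • F (radial d a t) i = 0 := by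
      generalize ⟪w i, F (radial d a t) i⟫ = τ at hwi
      rw [hwi, smul_smul, ← add_smul]
      refine smul_eq_zero_of_left ?_ _
      field_simp
      ring
    have e := (hnorm.inv hni).smul ((hasDerivAt_pi.1 hw) i)
    rw [← hz]
    exact e
  have hconst : ∀ i, ‖F (radial d a t) i‖⁻¹ • F (radial d a t) i = ‖F a i‖⁻¹ • F a i := by
    intro i
    have := isOpen_Ioi.is_const_of_deriv_eq_zero isPreconnected_Ioi
      (f := fun t => ‖F (radial d a t) i‖⁻¹ • F (radial d a t) i) (𝕜 := ℝ)
      (fun t ht => (hder i t ht).differentiableAt.differentiableWithinAt)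
      (fun t ht => (hder i t ht).deriv) (Set.mem_Ioi.2 ht) (frameLeaf.level_pos ha)
    simpa only [radial_level ha] using this
  ext1 i
  have hb := hmem t ht
  rw [radial, ← frameLeaf.norm_eq hb, div_eq_mul_inv, mul_smul, ← hconst i, smul_smul,
    mul_inv_cancel₀ (frameLeaf.norm_pos hb i).ne', one_smul]

end SpeedIso

/-! ### Metrics on the orbits and the comparison of types. -/

theorem exists_mem_frameLeaf {d : Fin 3 → ℝ} (hd : ∀ i, 0 ≤ d i) (hd2 : d 2 = 0) :
    ∃ a, a ∈ frameLeaf d := by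
  let e : Frame := ![-EuclideanSpace.single 0 1, EuclideanSpace.single 1 1, EuclideanSpace.single 2 1]
  have he : e ∈ frameLeaf 0 := by
    refine ⟨?_, ?_, ?_⟩
    · simp [e, frameDet, Matrix.det_fin_three]
    · intro i j hij
      fin_cases i <;> fin_cases j <;> first | exact absurd rfl hij | simp [e, EuclideanSpace.inner_single_left]
    · intro i
      fin_cases i <;> simp [e]
  have hn : ∀ i, ‖e i‖ = 1 := by
    intro i
    fin_cases i <;> simp [e]
  have hp : ∀ i, 0 < 1 + d i := fun i => by linarith [hd i]
  refine ⟨_, frameLeaf.smul_mem (v := fun i => √(1 + d i)) he (fun i => Real.sqrt_pos.2 (hp i))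
    fun i => ?_⟩
  rw [hn, hn, mul_one, mul_one, Real.sq_sqrt (hp i).le, Real.sq_sqrt (hp 2).le, hd2, add_zero]

/-- The squared lengths of the generators of rotations at level `t`. -/
noncomputable def orbitMetric (d : Fin 3 → ℝ) (k : Fin 3) (t : ℝ) : ℝ :=
  √(t + d (k + 1)) * √(t + d (k + 2)) / √(t + d k)

/-- Rescaling multiplies `mₖ` by the ratios of the norms with indices `k + 1` and `k + 2`; dividing
the squares by the product of the norms leaves `orbitMetric`. The hypothesis `hw` removes `τ`. -/
theorem speedSq_rescale {d : Fin 3 → ℝ} {b w : Frame} (hw : ⟪w 0, b 0⟫ = 0) {t : ℝ}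
    (ht : ∀ i, 0 < t + d i) (hn : ∀ i, ‖radial d b t i‖ = √(t + d i)) :
    speedSq (radial d b t) (fun i => (√(t + d i) / ‖b i‖) • w i) =
      (⟪w 1, b 2⟫ / (‖b 1‖ * ‖b 2‖)) ^ 2 * orbitMetric d 0 t +
      (⟪w 2, b 0⟫ / (‖b 2‖ * ‖b 0‖)) ^ 2 * orbitMetric d 1 t +
      (⟪w 0, b 1⟫ / (‖b 0‖ * ‖b 1‖)) ^ 2 * orbitMetric d 2 t := by
  have h0 := (Real.sqrt_pos.2 (ht 0)).ne'
  have h1 := (Real.sqrt_pos.2 (ht 1)).ne'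
  have h2 := (Real.sqrt_pos.2 (ht 2)).ne'
  have e1 : (1 : Fin 3) + 1 = 2 := rfl
  have e2 : (1 : Fin 3) + 2 = 0 := rfl
  have e3 : (2 : Fin 3) + 1 = 0 := rfl
  have e4 : (2 : Fin 3) + 2 = 1 := rfl
  simp only [speedSq, hn, orbitMetric, e1, e2, e3, e4, zero_add]
  simp only [Fin.sum_univ_four, Fin.prod_univ_three, tangentCoord, radial, inner_smul_left,
    inner_smul_right, Matrix.cons_val_zero, Matrix.cons_val_one, Matrix.cons_val, hw]
  simp only [conj_trivial]
  field_simp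
  ring

namespace SpeedIso

variable {d d' : Fin 3 → ℝ} {F G : Frame → Frame}

/-- An isomorphism identifies the orbit metrics along radial curves. -/
theorem exists_orbitMetric_eq (h : SpeedIso (frameLeaf d) (frameLeaf d') F G)
    (hd : ∀ i, 0 ≤ d i) (hd2 : d 2 = 0) (hd' : ∀ i, 0 ≤ d' i) (hd2' : d' 2 = 0) :
    ∃ (C : ℝ) (c : Fin 3 → ℝ) (s : ℝ → ℝ), 0 < C ∧ (∀ i, 0 ≤ c i) ∧
      Filter.Tendsto s (𝓝[>] 0) (𝓝 0) ∧ (∀ t, 0 < t → 0 < s t) ∧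
      ∀ t, 0 < t → C * orbitMetric d 2 t = ∑ i, c i * orbitMetric d' i (s t) := by
  obtain ⟨a, ha⟩ := exists_mem_frameLeaf hd hd2
  -- A rotation in the plane of `a 0` and `a 1` moves within a level and has only the coordinate
  -- `m₂`, whose coefficient `orbitMetric d 2` is the largest one.
  obtain ⟨γ, hγ0, hγ, hγn, hγd⟩ := exists_curve_rotation ha (a 0) (a 1)
  obtain ⟨w, hw, -⟩ := h.speed γ _ 0 hγ hγd
  have hFγ : ∀ᶠ x in 𝓝 (0 : ℝ), F (γ x) ∈ frameLeaf d' := hγ.mono fun x hx => h.mapsTo hx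
  have hFγn : ∀ᶠ x in 𝓝 (0 : ℝ), ‖F (γ x) 2‖ = ‖F a 2‖ := hγ.mono fun x hx =>
    h.level_congr hd hd2 hd' hd2' hx ha (hγn x)
  have hFa := h.mapsTo ha
  have hT : FrameTangent (F a) w := by
    have := FrameTangent.of_hasDerivAt hw hFγ
    rwa [hγ0] at this
  have hw0 : ⟪w 0, F a 0⟫ = 0 := by
    have h1 := hw.level 2
    have h2 := (hasDerivAt_const (0 : ℝ) (‖F a 2‖ ^ 2)).congr_of_eventuallyEq
      (f₁ := fun x => ‖F (γ x) 2‖ ^ 2) (hFγn.mono fun x hx => by simp only [hx])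
    have h3 := h1.unique h2
    rw [hγ0] at h3
    rw [hT.diag 0 2]
    linarith
  set u : Frame := fun i => ⟪a 0, a i⟫ • a 1 - ⟪a 1, a i⟫ • a 0 with hu
  have h01 := ha.2.1 0 1 (by decide)
  have h10 := ha.2.1 1 0 (by decide)
  have h02 := ha.2.1 0 2 (by decide)
  have h20 := ha.2.1 2 0 (by decide)
  have h12 := ha.2.1 1 2 (by decide)
  have n0 := frameLeaf.norm_pos ha 0
  have n1 := frameLeaf.norm_pos ha 1
  refine ⟨(‖a 0‖ * ‖a 1‖) ^ 2, ![(⟪w 1, F a 2⟫ / (‖F a 1‖ * ‖F a 2‖)) ^ 2,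
    (⟪w 2, F a 0⟫ / (‖F a 2‖ * ‖F a 0‖)) ^ 2, (⟪w 0, F a 1⟫ / (‖F a 0‖ * ‖F a 1‖)) ^ 2],
    fun t => ‖F (radial d a t) 2‖ ^ 2, by positivity, ?_, h.tendsto_level hd hd2 hd' ha,
    fun t ht => frameLeaf.level_pos (h.mapsTo (radial_mem hd hd2 ha ht)), ?_⟩
  · intro i
    fin_cases i <;> exact sq_nonneg _
  intro t ht
  have hs := frameLeaf.level_pos (h.mapsTo (radial_mem hd hd2 ha ht))
  set s := ‖F (radial d a t) 2‖ ^ 2 with hsdef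
  have hnorm : ∀ᶠ x in 𝓝 (0 : ℝ), ∀ i, ‖γ x i‖ = ‖a i‖ := hγ.mono fun x hx i => by
    rw [frameLeaf.norm_eq hx, frameLeaf.norm_eq ha, hγn]
  have hFnorm : ∀ᶠ x in 𝓝 (0 : ℝ), ∀ i, ‖F (γ x) i‖ = ‖F a i‖ := by
    filter_upwards [hFγ, hFγn] with x hx hx' i
    rw [frameLeaf.norm_eq hx, frameLeaf.norm_eq hFa, hx']
  have hder1 : HasDerivAt (fun x => radial d (γ x) t) (fun i => (√(t + d i) / ‖a i‖) • u i) 0 := by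
    have h1 : HasDerivAt (fun x i => (√(t + d i) / ‖a i‖) • γ x i)
        (fun i => (√(t + d i) / ‖a i‖) • u i) 0 :=
      hasDerivAt_pi.2 fun i => (hasDerivAt_pi.1 hγd i).const_smul (√(t + d i) / ‖a i‖)
    refine h1.congr_of_eventuallyEq (hnorm.mono fun x hx => ?_)
    ext1 i
    simp only [radial, hx]
  -- Radial curves go to radial curves, and the image level `s` is the same for all `x`. So the
  -- image at level `t` is a rescaling of the image of `γ`, and the coefficients come from the one
  -- velocity `w`.
  have hder2 : HasDerivAt (fun x => F (radial d (γ x) t))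
      (fun i => (√(s + d' i) / ‖F a i‖) • w i) 0 := by
    have h1 : HasDerivAt (fun x i => (√(s + d' i) / ‖F a i‖) • F (γ x) i)
        (fun i => (√(s + d' i) / ‖F a i‖) • w i) 0 :=
      hasDerivAt_pi.2 fun i => (hasDerivAt_pi.1 hw i).const_smul (√(s + d' i) / ‖F a i‖)
    refine h1.congr_of_eventuallyEq ?_
    filter_upwards [hγ, hFnorm] with x hx hx'
    rw [h.map_radial hd hd2 hd' hd2' hx ht]
    have : ‖F (radial d (γ x) t) 2‖ = ‖F (radial d a t) 2‖ :=
      h.level_congr hd hd2 hd' hd2' (radial_mem hd hd2 hx ht) (radial_mem hd hd2 ha ht)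
        (by rw [norm_radial hx, norm_radial ha])
    rw [this]
    ext1 i
    simp only [radial, hx', hsdef]
  obtain ⟨w', hw', hspeed⟩ := h.speed _ _ 0 (hγ.mono fun x hx => radial_mem hd hd2 hx ht) hder1
  rw [hw'.unique hder2, hγ0, h.map_radial hd hd2 hd' hd2' ha ht, ← hsdef,
    speedSq_rescale hw0 (fun i => add_pos_of_pos_of_nonneg hs (hd' i)) (norm_radial hFa s),
    speedSq_rescale (by simp [hu, inner_smul_left, h10])
      (fun i => add_pos_of_pos_of_nonneg ht (hd i)) (norm_radial ha t)] at hspeed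
  rw [Fin.sum_univ_three]
  refine Eq.trans ?_ hspeed.symm
  simp only [hu, inner_sub_left, inner_smul_left, h01, h10, h02, h12, real_inner_self_eq_norm_sq]
  simp
  field_simp
  simp

theorem leafType_le {q r q' r' : ℝ} (hq : 0 ≤ q) (hr : 0 ≤ r) (hq' : 0 ≤ q') (hr' : 0 ≤ r')
    (h : SpeedIso (frameLeaf ![q + r, r, 0]) (frameLeaf ![q' + r', r', 0]) F G) :
    leafType q r ≤ leafType q' r' := by
  by_contra! hlt
  have hd : ∀ i, 0 ≤ (![q + r, r, 0] : Fin 3 → ℝ) i := by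
    intro i; fin_cases i
    · exact add_nonneg hq hr
    · exact hr
    · exact le_rfl
  have hd' : ∀ i, 0 ≤ (![q' + r', r', 0] : Fin 3 → ℝ) i := by
    intro i; fin_cases i
    · exact add_nonneg hq' hr'
    · exact hr'
    · exact le_rfl
  obtain ⟨C, c, s, hC, hc, hs0, hspos, heq⟩ := h.exists_orbitMetric_eq hd rfl hd' rfl
  have hr0 : r' = 0 := by
    by_contra hne
    have : 0 < r' := lt_of_le_of_ne hr' (Ne.symm hne)
    simp only [leafType, this, if_true] at hlt
    split_ifs at hlt <;> omega
  subst hr0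
  -- A drop in type leaves two cases: from type 2 to type 1 or 0, or from type 1 to type 0.
  have hcases : (0 < r) ∨ (r = 0 ∧ 0 < q ∧ q' = 0) := by
    rcases hr.lt_or_eq with h1 | h1
    · exact Or.inl h1
    refine Or.inr ⟨h1.symm, ?_⟩
    subst h1
    simp only [leafType, lt_irrefl, if_false] at hlt
    have hq'' : ¬ 0 < q' := fun e => by
      rw [if_pos e] at hlt
      split_ifs at hlt <;> omega
    rw [if_neg hq''] at hlt
    refine ⟨?_, le_antisymm (not_lt.1 hq'') hq'⟩
    by_contra e
    rw [if_neg e] at hlt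
    omega
  have hsum := hc 0
  have hsum1 := hc 1
  have hsum2 := hc 2
  -- For `r' = 0` all three orbit metrics of the target are at most `√(s + q')`. Squaring and
  -- clearing denominators gives a polynomial bound.
  have hbound : ∀ t, 0 < t → C ^ 2 * ((t + q + r) * (t + r)) ≤
      (c 0 + c 1 + c 2) ^ 2 * (t * (s t + q')) := by
    intro t ht
    have e := heq t ht
    have hst := hspos t ht
    have e1 : (1 : Fin 3) + 1 = 2 := rfl
    have e2 : (1 : Fin 3) + 2 = 0 := rfl
    have e3 : (2 : Fin 3) + 1 = 0 := rfl
    have e4 : (2 : Fin 3) + 2 = 1 := rfl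
    simp only [orbitMetric, Fin.sum_univ_three, e1, e2, e3, e4, zero_add] at e
    simp only [Matrix.cons_val_zero, Matrix.cons_val_one, Matrix.cons_val, add_zero] at e
    have p0 : 0 < s t + q' := by linarith
    have i1 : √(s t) ≤ √(s t + q') := Real.sqrt_le_sqrt (by linarith)
    have hs' := Real.sqrt_pos.2 hst
    have hp' := Real.sqrt_pos.2 p0
    have ht' := Real.sqrt_pos.2 ht
    have f1 : √(s t) * √(s t) / √(s t + q') ≤ √(s t + q') := by
      rw [div_le_iff₀ hp']
      gcongr
    have f2 : √(s t) * √(s t + q') / √(s t) = √(s t + q') := by field_simp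
    have f3 : √(s t + q') * √(s t) / √(s t) = √(s t + q') := by field_simp
    rw [f2, f3] at e
    have g : C * (√(t + (q + r)) * √(t + r) / √t) ≤ (c 0 + c 1 + c 2) * √(s t + q') := by
      rw [e]
      have := mul_le_mul_of_nonneg_left f1 hsum
      linarith
    have g2 : C * (√(t + (q + r)) * √(t + r)) ≤ (c 0 + c 1 + c 2) * (√t * √(s t + q')) := by
      have := mul_le_mul_of_nonneg_left g ht'.le
      field_simp at this
      linarith
    have g3 := pow_le_pow_left₀ (by positivity) g2 2
    simp only [mul_pow] at g3
    rwa [Real.sq_sqrt (by linarith), Real.sq_sqrt (by linarith), Real.sq_sqrt ht.le,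
      Real.sq_sqrt p0.le, ← add_assoc] at g3
  have hid : Filter.Tendsto (fun t : ℝ => t) (𝓝[>] 0) (𝓝 0) := nhdsWithin_le_nhds
  have hpos : ∀ᶠ t : ℝ in 𝓝[>] 0, 0 < t := self_mem_nhdsWithin
  -- As `t → 0`, the bound yields `C² (q + r) r ≤ 0` in the first case and, after division by `t`,
  -- `C² q ≤ 0` in the second.
  rcases hcases with h1 | ⟨rfl, h2, rfl⟩
  · have l1 : Filter.Tendsto (fun t : ℝ => C ^ 2 * ((t + q + r) * (t + r))) (𝓝[>] 0)
        (𝓝 (C ^ 2 * ((0 + q + r) * (0 + r)))) :=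
      (((hid.add_const q).add_const r).mul (hid.add_const r)).const_mul _
    have l2 : Filter.Tendsto (fun t : ℝ => (c 0 + c 1 + c 2) ^ 2 * (t * (s t + q'))) (𝓝[>] 0)
        (𝓝 ((c 0 + c 1 + c 2) ^ 2 * (0 * (0 + q')))) :=
      (hid.mul (hs0.add_const q')).const_mul _
    have := le_of_tendsto_of_tendsto l1 l2 (hpos.mono fun t ht => hbound t ht)
    have : 0 < C ^ 2 * ((0 + q + r) * (0 + r)) := by
      have : 0 < q + r := by linarith
      simp only [zero_add]
      positivity
    linarith
  · have l1 : Filter.Tendsto (fun t : ℝ => C ^ 2 * (t + q)) (𝓝[>] 0) (𝓝 (C ^ 2 * (0 + q))) :=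
      (hid.add_const q).const_mul _
    have l2 : Filter.Tendsto (fun t : ℝ => (c 0 + c 1 + c 2) ^ 2 * s t) (𝓝[>] 0)
        (𝓝 ((c 0 + c 1 + c 2) ^ 2 * 0)) := hs0.const_mul _
    have := le_of_tendsto_of_tendsto l1 l2 (hpos.mono fun t ht => by
      have e := hbound t ht
      simp only [add_zero] at e
      refine le_of_mul_le_mul_right ?_ ht
      linarith)
    have : 0 < C ^ 2 * (0 + q) := by rw [zero_add]; positivity
    linarith

end SpeedIso

/-! ### From hyperkähler isomorphisms to speed-preserving maps of frames. -/

section Transport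

variable {E : Type*} [NormedAddCommGroup E] [NormedSpace ℝ E]

theorem SmoothOnSubmanifold.differentiableOn {F : E → E} {M : Set E}
    (h : SmoothOnSubmanifold F M) : DifferentiableOn ℝ F M := by
  intro p hp
  obtain ⟨U, hU, hpU, G, hG, hFG⟩ := h p hp
  have h1 : DifferentiableAt ℝ G p :=
    (hG.differentiableOn (by simp) p hpU).differentiableAt (hU.mem_nhds hpU)
  refine (h1.differentiableWithinAt (s := M)).congr_of_eventuallyEq ?_ (hFG ⟨hp, hpU⟩)
  filter_upwards [self_mem_nhdsWithin, mem_nhdsWithin_of_mem_nhds (hU.mem_nhds hpU)] with x hx hxU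
  exact hFG ⟨hx, hxU⟩

theorem DifferentiableOn.hasDerivAt_comp_curve {F : E → E} {M : Set E} (h : DifferentiableOn ℝ F M)
    {γ : ℝ → E} {u : E} {t : ℝ} (hγ : ∀ᶠ x in 𝓝 t, γ x ∈ M) (hu : HasDerivAt γ u t) :
    HasDerivAt (fun x => F (γ x)) (fderivWithin ℝ F M (γ t) u) t :=
  (h (γ t) hγ.self_of_nhds).hasFDerivWithinAt.comp_hasDerivAt t hu hγ

theorem mem_tangentVectors_of_hasDerivAt {M : Set E} {γ : ℝ → E} {u : E} {t : ℝ}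
    (hγ : ∀ᶠ x in 𝓝 t, γ x ∈ M) (hu : HasDerivAt γ u t) : u ∈ tangentVectors M (γ t) := by
  refine ⟨fun x => γ (x + t), by simp, ?_, ?_⟩
  · have : Filter.Tendsto (fun x : ℝ => x + t) (𝓝 0) (𝓝 t) :=
      Continuous.tendsto' (by fun_prop) _ _ (zero_add t)
    exact this.eventually hγ
  · exact HasDerivAt.comp_add_const (0 : ℝ) t (by rwa [zero_add])

/-- An isomorphism of hyperkähler structures on leaves preserves the speed of curves. -/
theorem exists_speedIso_of_hyperkahlerIsomorphic (e : E ≃L[ℝ] Frame) {d d' : Fin 3 → ℝ}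
    (hd : ∀ i, 0 ≤ d i) (hd2 : d 2 = 0) {κ : ℝ} (hκ : κ ≠ 0) {M M' : Set E}
    (hM : ∀ a, a ∈ M ↔ e a ∈ frameLeaf d) (hM' : ∀ a, a ∈ M' ↔ e a ∈ frameLeaf d')
    {ω : Fin 3 → E → E → E → ℝ}
    (hω : ∀ a, frameDet (e a) ≠ 0 → ∀ u v, FrameTangent (e a) (e u) → FrameTangent (e a) (e v) →
      ∀ k, ω k a u v = κ * (1 / frameDet (e a) *
        (tangentCoord (e a) (e u) ⬝ᵥ (formMatrix k).mulVec (tangentCoord (e a) (e v)))))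
    (h : HyperkahlerIsomorphic M ω M' ω) :
    ∃ F G, SpeedIso (frameLeaf d) (frameLeaf d') F G := by
  obtain ⟨F, ⟨hbij, hF, G, hinv, hG⟩, O, hO, hform⟩ := h
  have hF' := hF.differentiableOn
  have hG' := hG.differentiableOn
  have hmapsG : Set.MapsTo G M' M := by
    intro b hb
    obtain ⟨a, ha, rfl⟩ := hbij.surjOn hb
    rwa [hinv.1 ha]
  have hsymm : ∀ a, a ∈ frameLeaf d → e.symm a ∈ M := fun a ha => by
    rw [hM, e.apply_symm_apply]; exact ha
  have hsymm' : ∀ a, a ∈ frameLeaf d' → e.symm a ∈ M' := fun a ha => by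
    rw [hM', e.apply_symm_apply]; exact ha
  have hcurve : ∀ {γ : ℝ → Frame} {u t}, HasDerivAt γ u t →
      HasDerivAt (fun x => e.symm (γ x)) (e.symm u) t := fun {γ u t} hγ =>
    (e.symm.hasFDerivAt (x := γ t)).comp_hasDerivAt t hγ
  have hcurve' : ∀ {γ : ℝ → E} {u t}, HasDerivAt γ u t →
      HasDerivAt (fun x => e (γ x)) (e u) t := fun {γ u t} hγ =>
    (e.hasFDerivAt (x := γ t)).comp_hasDerivAt t hγ
  have hspeed : ∀ (γ : ℝ → Frame) (u : Frame) (t : ℝ), (∀ᶠ x in 𝓝 t, γ x ∈ frameLeaf d) →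
      HasDerivAt γ u t → ∃ w, HasDerivAt (fun x => e (F (e.symm (γ x)))) w t ∧
        speedSq (e (F (e.symm (γ t)))) w = speedSq (γ t) u := by
    intro γ u t hγ hu
    have ha : γ t ∈ frameLeaf d := hγ.self_of_nhds
    set a := γ t with ha_def
    have hp := hsymm a ha
    have hFp := hbij.mapsTo hp
    let D : Frame →ₗ[ℝ] Frame := (e : E →ₗ[ℝ] Frame) ∘ₗ
      (fderivWithin ℝ F M (e.symm a) : E →ₗ[ℝ] E) ∘ₗ (e.symm : Frame →ₗ[ℝ] E)
    have hD : ∀ {δ : ℝ → Frame} {v s}, δ s = a → (∀ᶠ x in 𝓝 s, δ x ∈ frameLeaf d) →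
        HasDerivAt δ v s → HasDerivAt (fun x => e (F (e.symm (δ x)))) (D v) s := by
      intro δ v s hδs hδ hv
      have := hcurve' (hF'.hasDerivAt_comp_curve (hδ.mono fun x hx => hsymm _ hx) (hcurve hv))
      rw [hδs] at this
      exact this
    -- The differential within `M` determines the derivative along every curve in the leaf, so the
    -- hypothesis on forms becomes that of `speedSq_eq_of_forms`.
    refine ⟨D u, hD rfl hγ hu, ?_⟩
    have hT : ∀ v ∈ tangentVectors (frameLeaf d) a, e.symm v ∈ tangentVectors M (e.symm a) ∧
        FrameTangent a v ∧ FrameTangent (e (F (e.symm a))) (D v) := by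
      rintro v ⟨δ, hδ0, hδ, hv⟩
      refine ⟨?_, ?_, ?_⟩
      · rw [← hδ0]
        exact mem_tangentVectors_of_hasDerivAt (γ := fun x => e.symm (δ x))
          (hδ.mono fun x hx => hsymm _ hx) (hcurve hv)
      · rw [← hδ0]
        exact FrameTangent.of_hasDerivAt hv hδ
      · have := FrameTangent.of_hasDerivAt (hD hδ0 hδ hv)
          (hδ.mono fun x hx => (hM' _).1 (hbij.mapsTo (hsymm _ hx)))
        rwa [hδ0] at this
    refine speedSq_eq_of_forms hd hd2 ha ((hM' _).1 hFp) D hO ?_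
      (hT u (mem_tangentVectors_of_hasDerivAt hγ hu)).2.1
    intro v hv w hw k
    obtain ⟨hv1, hv2, hv3⟩ := hT v hv
    obtain ⟨hw1, hw2, hw3⟩ := hT w hw
    have key := hform (e.symm a) hp _ hv1 _ hw1 k
    rw [hω (F (e.symm a)) ((hM' _).1 hFp).1.ne (fderivWithin ℝ F M (e.symm a) (e.symm v))
      (fderivWithin ℝ F M (e.symm a) (e.symm w)) hv3 hw3] at key
    have hae : e (e.symm a) = a := e.apply_symm_apply a
    have hsum : ∀ j, ω j (e.symm a) (e.symm v) (e.symm w) = κ * (1 / frameDet a *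
        (tangentCoord a v ⬝ᵥ (formMatrix j).mulVec (tangentCoord a w))) := fun j => by
      have := hω (e.symm a) (by rw [hae]; exact ha.1.ne) (e.symm v) (e.symm w)
        (by simpa only [e.apply_symm_apply] using hv2) (by simpa only [e.apply_symm_apply] using hw2) j
      simpa only [e.apply_symm_apply] using this
    simp only [hsum, mul_assoc] at key
    rw [← Finset.mul_sum] at key
    have key2 := mul_left_cancel₀ hκ key
    simp only [mul_assoc]
    exact key2
  have hleft : ∀ a ∈ frameLeaf d, e (G (e.symm (e (F (e.symm a))))) = a := fun a ha => by
    rw [e.symm_apply_apply, hinv.1 (hsymm a ha), e.apply_symm_apply]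
  have hright : ∀ b ∈ frameLeaf d', e (F (e.symm (e (G (e.symm b))))) = b := fun b hb => by
    rw [e.symm_apply_apply, hinv.2 (hsymm' b hb), e.apply_symm_apply]
  have hmaps' : Set.MapsTo (fun b => e (G (e.symm b))) (frameLeaf d') (frameLeaf d) := fun b hb =>
    (hM _).1 (hmapsG (hsymm' b hb))
  refine ⟨fun a => e (F (e.symm a)), fun b => e (G (e.symm b)),
    fun a ha => (hM' _).1 (hbij.mapsTo (hsymm a ha)), hmaps', hleft, hright, ?_, ?_, hspeed, ?_⟩
  · exact e.continuous.comp_continuousOn (hF'.continuousOn.comp e.symm.continuous.continuousOn hsymm)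
  · exact e.continuous.comp_continuousOn
      (hG'.continuousOn.comp e.symm.continuous.continuousOn hsymm')
  · intro γ u t hγ hu
    have hGγ := hcurve' (hG'.hasDerivAt_comp_curve (hγ.mono fun x hx => hsymm' _ hx) (hcurve hu))
    refine ⟨_, hGγ, ?_⟩
    -- The speed under `G` follows from that under `F`, applied to the curve `G ∘ γ`, which `F` maps
    -- back to `γ`.
    obtain ⟨w, hw, hs⟩ := hspeed _ _ t (hγ.mono fun x hx => hmaps' hx) hGγ
    have hwu : w = u := hw.unique
      (hu.congr_of_eventuallyEq (hγ.mono fun x hx => hright _ hx))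
    rw [hwu] at hs
    have hb := hright _ hγ.self_of_nhds
    simp only at hs
    rw [hb] at hs
    exact hs.symm

end Transport

/-! ### Back from Euclidean frames to `su(2)³`. -/

noncomputable def tripleEquiv (c : ℝ) (hc : 0 < c) : Triple ≃L[ℝ] Frame :=
  ContinuousLinearEquiv.piCongrRight fun _ => LinearEquiv.toContinuousLinearEquiv (su2Equiv c hc)

theorem inner_tripleEquiv (c : ℝ) (hc : 0 < c) (a b : Triple) (i j : Fin 3) :
    ⟪tripleEquiv c hc a i, tripleEquiv c hc b j⟫ = ip c (a i) (b j) :=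
  inner_su2Equiv c hc _ _

/-- Three rows scaled by `√(c / 2)` give its cube, while `Φ` contains only its square. The remaining
factor becomes the constant `κ` in front of the forms. -/
theorem frameDet_tripleEquiv (c : ℝ) (hc : 0 < c) (a : Triple) :
    frameDet (tripleEquiv c hc a) = √(c / 2) * Phi c a := by
  have h : ∀ i j, tripleEquiv c hc a i j = √(c / 2) * su2Coord (a i) j := fun i j => rfl
  have := Real.mul_self_sqrt (show 0 ≤ c / 2 by positivity)
  rw [Phi, ip_comm, ip_lie_eq, frameDet, Matrix.det_fin_three]
  simp only [Matrix.of_apply, h]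
  generalize √(c / 2) = k at *
  rw [← this]
  ring

theorem mem_leaf_iff (c : ℝ) (hc : 0 < c) (q r : ℝ) (a : Triple) :
    a ∈ leaf c q r ↔ tripleEquiv c hc a ∈ frameLeaf ![q + r, r, 0] := by
  have hk : 0 < √(c / 2) := by positivity
  have hneg : frameDet (tripleEquiv c hc a) < 0 ↔ Phi c a < 0 := by
    rw [frameDet_tripleEquiv]
    constructor
    · intro h
      by_contra! h'
      exact h.not_ge (mul_nonneg hk.le h')
    · exact mul_neg_of_pos_of_neg hk
  simp only [leaf, frameLeaf, Set.mem_ofPred_eq, hneg, inner_tripleEquiv,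
    ← real_inner_self_eq_norm_sq]
  refine and_congr_right fun _ => and_congr_right fun _ => ?_
  rw [Fin.forall_fin_succ, Fin.forall_fin_two]
  simp
  constructor
  · rintro ⟨h1, h2⟩; constructor <;> linarith
  · rintro ⟨h1, h2⟩; constructor <;> linarith

theorem leafForm_eq_tangentCoord (c : ℝ) (hc : 0 < c) (a : Triple)
    (ha : frameDet (tripleEquiv c hc a) ≠ 0) (u v : Triple)
    (hu : FrameTangent (tripleEquiv c hc a) (tripleEquiv c hc u))
    (hv : FrameTangent (tripleEquiv c hc a) (tripleEquiv c hc v)) (k : Fin 3) :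
    leafForm c k a u v = √(c / 2) * (1 / frameDet (tripleEquiv c hc a) *
      (tangentCoord (tripleEquiv c hc a) (tripleEquiv c hc u) ⬝ᵥ
        (formMatrix k).mulVec (tangentCoord (tripleEquiv c hc a) (tripleEquiv c hc v)))) := by
  have htr : ∀ w : Triple, FrameTangent (tripleEquiv c hc a) (tripleEquiv c hc w) →
      TangentRel c a w := fun w hw =>
    ⟨fun i j => by simpa only [inner_tripleEquiv] using hw.diag i j,
      fun i j hij => by simpa only [inner_tripleEquiv] using hw.off i j hij⟩
  have hk : √(c / 2) ≠ 0 := by positivity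
  rw [frameDet_tripleEquiv] at ha ⊢
  have hPhi : Phi c a ≠ 0 := right_ne_zero_of_mul ha
  have e1 : (1 : Fin 3) + 1 = 2 := rfl
  have e2 : (1 : Fin 3) + 2 = 0 := rfl
  have e3 : (2 : Fin 3) + 1 = 0 := rfl
  have e4 : (2 : Fin 3) + 2 = 1 := rfl
  rw [leafForm_eq hPhi (htr u hu) (htr v hv)]
  simp only [tangentCoord, inner_tripleEquiv]
  fin_cases k <;>
    simp [formMatrix, Matrix.mulVec, dotProduct, Fin.sum_univ_four, e1, e2, e3, e4] <;>
    field_simp <;> ring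

theorem leafType_eq_of_hyperkahlerIsomorphic (c : ℝ) (hc : 0 < c) {q r q' r' : ℝ}
    (hq : 0 ≤ q) (hr : 0 ≤ r) (hq' : 0 ≤ q') (hr' : 0 ≤ r')
    (h : HyperkahlerIsomorphic (leaf c q r) (leafForm c) (leaf c q' r') (leafForm c)) :
    leafType q r = leafType q' r' := by
  have hd : ∀ i, 0 ≤ (![q + r, r, 0] : Fin 3 → ℝ) i := by
    intro i; fin_cases i
    · exact add_nonneg hq hr
    · exact hr
    · exact le_rfl
  obtain ⟨F, G, hFG⟩ := exists_speedIso_of_hyperkahlerIsomorphic (tripleEquiv c hc) hd rfl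
    (show √(c / 2) ≠ 0 by positivity) (mem_leaf_iff c hc q r) (mem_leaf_iff c hc q' r')
    (leafForm_eq_tangentCoord c hc · · · · · · ·) h
  exact le_antisymm (hFG.leafType_le hq hr hq' hr') (hFG.symm.leafType_le hq' hr' hq hr)

theorem mainTheorem2 (c : ℝ) (hc : 0 < c) (q r q' r' : ℝ)
    (hq : 0 ≤ q) (hr : 0 ≤ r) (hq' : 0 ≤ q') (hr' : 0 ≤ r')
    (htype : leafType q r ≠ leafType q' r') :
    ¬ HyperkahlerIsomorphic (leaf c q r) (leafForm c) (leaf c q' r') (leafForm c) :=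
  fun h => htype (leafType_eq_of_hyperkahlerIsomorphic c hc hq hr hq' hr' h)
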